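/- Let $\mathcal T$ be a normal (face-to-face) tiling of $\mathbb R^d$ by translates of a $d$-dimensional convex polytope $P$ (so $P$ is a parallelohedron): the cells cover $\mathbb R^d$, have pairwise disjoint interiors, and the intersection of two distinct cells is empty or a face of both. A *facet* of $\mathcal T$ is a $(d-1)$-dimensional face of a cell; two cells are *adjacent* if they have a common facet. A *canonical scaling* of $\mathcal T$ is a function $s$ assigning a positive real number to each facet of $\mathcal T$ such that for every $(d-2)$-dimensional face $G$ of $\mathcal T$ one has $\sum_{F\supset G}s(F)\,\mathbf n_F=0$, where $F$ runs over the facets of $\mathcal T$ containing $G$ and the unit normals $\mathbf n_F$ to $F$ are all directed according to one and the same direction of going around $G$ (that is, in the projection along $G$ to the orthogonal plane, each $\mathbf n_F$ points to the counterclockwise side of the segment onto which $F$ is projected, for a fixed orientation of the plane; the choice of the orientation only changes the sign of the sum). The scaling $s$ is *translation invariant* if $s(F+t)=s(F)$ for all facets $F$ and all translations $t$ that map $\mathcal T$ to itself. Let $s$ be a translation-invariant canonical scaling of $\mathcal T$. Fix a cell $P_0$ of $\mathcal T$, and let $P_1,\dots,P_k$ be all the cells adjacent to $P_0$ (each listed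 once). Let $\mathbf p_i=c(P_i)-c(P_0)$, where $c(C)$ denotes the center of a cell $C$, let $\mathbf n_{0,i}$ be the unit normal to the facet $P_0\cap P_i$ directed from $P_0$ to $P_i$, and let $\mathbf m_i=s(P_0\cap P_i)\,\mathbf n_{0,i}$. Let $\mathcal P=(\mathbf p_1|\dots|\mathbf p_k)$ and $\mathcal M=(\mathbf m_1|\dots|\mathbf m_k)$ be the $d\times k$ matrices with columns $\mathbf p_i$ and $\mathbf m_i$ respectively. Then there exists a unique symmetric nondegenerate real $d\times d$ matrix $Q$ such that $\mathcal M=Q\mathcal P$. -/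

import Mathlib

open scoped Pointwise InnerProductSpace

namespace Parallelohedra

/-- Euclidean space of dimension `d`. -/
abbrev E (d : ℕ) : Type := EuclideanSpace ℝ (Fin d)

/-- A `d`-dimensional convex polytope in `d`-dimensional space. -/
def IsFullPolytope {d : ℕ} (C : Set (E d)) : Prop :=
  (∃ S : Finset (E d), C = convexHull ℝ (S : Set (E d))) ∧ (interior C).Nonempty

/-- `F` is a nonempty face of the convex polytope `C` (possibly `C` itself): the set of maximum
points on `C` of a linear functional. -/
def IsFace {d : ℕ} (C F : Set (E d)) : Prop :=
  F.Nonempty ∧ IsExposed ℝ C F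

/-- The dimension of the affine hull of a nonempty set. -/
noncomputable def dim {d : ℕ} (F : Set (E d)) : ℕ :=
  Module.finrank ℝ (vectorSpan ℝ F)

/-- `F` is a hyperface, that is a `(d-1)`-dimensional face, of `C`. -/
def IsFacet {d : ℕ} (C F : Set (E d)) : Prop :=
  IsFace C F ∧ dim F + 1 = d

/-- `G` is a `(d-2)`-dimensional face of `C`. -/
def IsRidge {d : ℕ} (C G : Set (E d)) : Prop :=
  IsFace C G ∧ dim G + 2 = d

/-- A normal (face-to-face) tiling of `d`-dimensional space by convex `d`-polytopes; `T` is the set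
of its cells. -/
structure IsNormalTiling {d : ℕ} (T : Set (Set (E d))) : Prop where
  polytope : ∀ C ∈ T, IsFullPolytope C
  cover : ⋃₀ T = Set.univ
  disjoint_interior : T.Pairwise fun C C' => Disjoint (interior C) (interior C')
  face_to_face : T.Pairwise fun C C' =>
    C ∩ C' = ∅ ∨ (IsFace C (C ∩ C') ∧ IsFace C' (C ∩ C'))

/-- `T` is a normal tiling of space by translates of `P`; that is, `P` is a parallelohedron and
`T` is a tiling corresponding to it. -/
structure IsParallelohedralTiling {d : ℕ} (P : Set (E d)) (T : Set (Set (E d))) : Prop where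
  tiling : IsNormalTiling T
  translates : ∀ C ∈ T, ∃ t : E d, C = t +ᵥ P

/-- The hyperfaces of the tiling. -/
def facets {d : ℕ} (T : Set (Set (E d))) : Set (Set (E d)) :=
  {F | ∃ C ∈ T, IsFacet C F}

/-- The `(d-2)`-faces of the tiling. -/
def ridges {d : ℕ} (T : Set (Set (E d))) : Set (Set (E d)) :=
  {G | ∃ C ∈ T, IsRidge C G}

/-- The hyperfaces of the tiling that contain `G`. -/
def facetsContaining {d : ℕ} (T : Set (Set (E d))) (G : Set (E d)) : Set (Set (E d)) :=
  {F | F ∈ facets T ∧ G ⊆ F}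

/-- Two cells are adjacent if they have a common hyperface. -/
def Adjacent {d : ℕ} (C C' : Set (E d)) : Prop :=
  IsFacet C (C ∩ C') ∧ IsFacet C' (C ∩ C')

/-- `v` is a unit normal to the hyperface `F`. -/
def IsUnitNormal {d : ℕ} (F : Set (E d)) (v : E d) : Prop :=
  ‖v‖ = 1 ∧ ∀ w ∈ vectorSpan ℝ F, ⟪v, w⟫_ℝ = 0

/-- `v` is the unit normal to the common hyperface of the adjacent cells `C` and `C'`, directed
from `C` to `C'`. -/
def IsUnitNormalFromTo {d : ℕ} (C C' : Set (E d)) (v : E d) : Prop :=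
  IsUnitNormal (C ∩ C') v ∧
    ∀ x ∈ C ∩ C', (∀ y ∈ C, ⟪v, y - x⟫_ℝ ≤ 0) ∧ ∀ z ∈ C', 0 ≤ ⟪v, z - x⟫_ℝ

/-- `(e₁, e₂)` is an orthonormal basis of the plane orthogonal to the `(d-2)`-face `G`. Such a
basis fixes one of the two directions of going around `G`: counterclockwise in the coordinates
`(⟪e₁, ·⟫, ⟪e₂, ·⟫)`. -/
def IsFrameAround {d : ℕ} (G : Set (E d)) (e₁ e₂ : E d) : Prop :=
  Orthonormal ℝ ![e₁, e₂] ∧ Submodule.span ℝ {e₁, e₂} = (vectorSpan ℝ G)ᗮ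

/-- The unit normals `n F` to the hyperfaces `F` around the `(d-2)`-face `G` agree with the
direction of going around `G` fixed by `(e₁, e₂)`: in the projection along `G` each hyperface `F`
is seen as a segment issuing from the image of `G`, and `n F` points to the counterclockwise side
of it. -/
def AreCoherentNormals {d : ℕ} (T : Set (Set (E d))) (G : Set (E d)) (e₁ e₂ : E d)
    (n : Set (E d) → E d) : Prop :=
  ∀ F ∈ facetsContaining T G, IsUnitNormal F (n F) ∧
    ∀ g ∈ G, ∀ x ∈ F \ G,
      0 < ⟪e₁, x - g⟫_ℝ * ⟪e₂, n F⟫_ℝ - ⟪e₂, x - g⟫_ℝ * ⟪e₁, n F⟫_ℝ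

/-- The torsion of the scaling `s` around the `(d-2)`-face `G`, for a given choice `n` of the
unit normals to the hyperfaces around `G`. -/
noncomputable def torsion {d : ℕ} (T : Set (Set (E d))) (s : Set (E d) → ℝ) (G : Set (E d))
    (n : Set (E d) → E d) : E d :=
  ∑ᶠ F ∈ facetsContaining T G, s F • n F

/-- `s` is a canonical scaling of the tiling: it is positive on the hyperfaces and has zero torsion
around every `(d-2)`-face. Only the values of `s` on the hyperfaces of the tiling matter. -/
structure IsCanonicalScaling {d : ℕ} (T : Set (Set (E d))) (s : Set (E d) → ℝ) : Prop where
  pos : ∀ F ∈ facets T, 0 < s F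
  torsion_eq_zero : ∀ G ∈ ridges T, ∀ e₁ e₂ : E d, IsFrameAround G e₁ e₂ →
    ∀ n : Set (E d) → E d, AreCoherentNormals T G e₁ e₂ n → torsion T s G n = 0

/-- The scaling `s` is preserved by all translations that preserve the tiling. -/
def IsTranslationInvariant {d : ℕ} (T : Set (Set (E d))) (s : Set (E d) → ℝ) : Prop :=
  ∀ t : E d, (fun C : Set (E d) => t +ᵥ C) '' T = T → ∀ F ∈ facets T, s (t +ᵥ F) = s F

/-- The center of a cell, defined as its centroid. For a centrally symmetric cell this is the
center of symmetry, see `cellCenter_eq_of_symmetric`. -/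
noncomputable def cellCenter {d : ℕ} (C : Set (E d)) : E d :=
  ⨍ x in C, x ∂MeasureTheory.volume

/-- The matrix with columns `v 0, …, v (k-1)`. -/
def columnMatrix {d k : ℕ} (v : Fin k → E d) : Matrix (Fin d) (Fin k) ℝ :=
  Matrix.of fun a i => v i a

theorem IsFullPolytope.isCompact {d : ℕ} {C : Set (E d)} (hC : IsFullPolytope C) :
    IsCompact C := by
  obtain ⟨⟨S, rfl⟩, -⟩ := hC
  exact S.finite_toSet.isCompact_convexHull ℝ

theorem cellCenter_eq_of_symmetric {d : ℕ} {C : Set (E d)} (hC : IsFullPolytope C) (c : E d)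
    (hc : ∀ x ∈ C, (c + c) - x ∈ C) : cellCenter C = c := by
  have hcomp := hC.isCompact
  have hfin : MeasureTheory.volume C ≠ ⊤ := hcomp.measure_ne_top
  have hpos : MeasureTheory.volume C ≠ 0 := by
    have h := isOpen_interior.measure_pos MeasureTheory.volume hC.2
    exact (lt_of_lt_of_le h (MeasureTheory.measure_mono interior_subset)).ne'
  have hint : MeasureTheory.IntegrableOn (fun x : E d => x) C :=
    continuous_id.continuousOn.integrableOn_compact hcomp
  have hconst : ∀ v : E d, MeasureTheory.IntegrableOn (fun _ : E d => v) C :=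
    fun v => MeasureTheory.integrableOn_const hfin
  have hmp := MeasureTheory.Measure.measurePreserving_sub_left
    (MeasureTheory.volume : MeasureTheory.Measure (E d)) (c + c)
  have hpre : (fun x : E d => (c + c) - x) ⁻¹' C = C := by
    ext x
    refine ⟨fun h => ?_, fun h => hc x h⟩
    have := hc _ h
    simpa using this
  have key : ∫ x in C, ((c + c) - x) = ∫ x in C, x := by
    have h := hmp.setIntegral_preimage_emb
      (MeasurableEquiv.subLeft (c + c)).measurableEmbedding (fun x : E d => x) C
    rw [hpre] at h
    exact h
  rw [MeasureTheory.integral_sub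
    (hconst _) hint, MeasureTheory.setIntegral_const] at key
  have hr : MeasureTheory.volume.real C ≠ 0 := by
    simp [MeasureTheory.Measure.real, ENNReal.toReal_eq_zero_iff, hpos, hfin]
  have h2 : (∫ x in C, x) = MeasureTheory.volume.real C • c := by
    have h3 : (2 : ℝ) • (∫ x in C, x) = (2 : ℝ) • (MeasureTheory.volume.real C • c) := by
      rw [two_smul, two_smul, ← smul_add]
      exact (sub_eq_iff_eq_add.mp key).symm
    exact smul_right_injective _ (two_ne_zero) h3
  rw [cellCenter, MeasureTheory.setAverage_eq, h2, smul_smul, inv_mul_cancel₀ hr, one_smul]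

theorem cellCenter_vadd {d : ℕ} {C : Set (E d)} (hC : IsFullPolytope C) (t : E d) :
    cellCenter (t +ᵥ C) = t + cellCenter C := by
  have hcomp := hC.isCompact
  have hfin : MeasureTheory.volume C ≠ ⊤ := hcomp.measure_ne_top
  have hpos : MeasureTheory.volume C ≠ 0 := by
    have h := isOpen_interior.measure_pos MeasureTheory.volume hC.2
    exact (lt_of_lt_of_le h (MeasureTheory.measure_mono interior_subset)).ne'
  have hint : MeasureTheory.IntegrableOn (fun x : E d => x) C :=
    continuous_id.continuousOn.integrableOn_compact hcomp
  have hconst : ∀ v : E d, MeasureTheory.IntegrableOn (fun _ : E d => v) C :=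
    fun v => MeasureTheory.integrableOn_const hfin
  have hr : MeasureTheory.volume.real C ≠ 0 := by
    simp [MeasureTheory.Measure.real, ENNReal.toReal_eq_zero_iff, hpos, hfin]
  have hv : MeasureTheory.volume.real (t +ᵥ C) = MeasureTheory.volume.real C := by
    simp [MeasureTheory.Measure.real, MeasureTheory.measure_vadd]
  have himg : t +ᵥ C = (fun x : E d => t + x) '' C := rfl
  have key : ∫ x in t +ᵥ C, x = ∫ x in C, (t + x) := by
    rw [himg]
    exact (MeasureTheory.measurePreserving_add_left MeasureTheory.volume t).setIntegral_image_emb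
      (MeasurableEquiv.addLeft t).measurableEmbedding (fun x : E d => x) C
  rw [cellCenter, cellCenter, MeasureTheory.setAverage_eq, MeasureTheory.setAverage_eq, hv, key,
    MeasureTheory.integral_add (hconst _) hint,
    MeasureTheory.setIntegral_const, smul_add, smul_smul, inv_mul_cancel₀ hr, one_smul]

end Parallelohedra

/-!
A canonical scaling `s` prescribes the gradient jumps `s F • n_F` of a continuous function that is
affine on each cell. Since `s` has zero torsion around every `(d-2)`-face, the jumps met along a
generic path depend only on its endpoints, so such a function, the generatrix, exists. If `s` is
translation invariant, a translation `t` of the tiling adds one and the same vector `q t` to all the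
gradients, and comparing the constant terms on the cell `t + u + P₀`, reached in two orders, gives
`⟪q t, u⟫ = ⟪q u, t⟫`. The translations of the tiling span the space, hence `q` extends to a
symmetric linear map `Q`; on the translation `p_i` it takes the value `m_i`, the jump between `P₀`
and its neighbour `P_i`. As `P₀` is bounded, the `m_i` span the space, whence the nondegeneracy
and the uniqueness.
-/

namespace Parallelohedra

open Filter Topology

/-! ### Convex sets and exposed faces -/

section TopologicalVectorSpace

variable {V : Type*} [AddCommGroup V] [Module ℝ V] [TopologicalSpace V]

theorem exists_forall_mul_add_le {S : Finset V} {l m : StrongDual ℝ V} {x : V}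
    (hl : ∀ y ∈ S, l y ≤ l x) (hm : ∀ y ∈ S, l y = l x → m y ≤ m x) :
    ∃ N : ℝ, ∀ y ∈ convexHull ℝ (S : Set V), N * l y + m y ≤ N * l x + m x := by
  have hvertex : ∀ y ∈ S, ∀ᶠ N : ℝ in atTop, N * l y + m y ≤ N * l x + m x := by
    intro y hy
    rcases (hl y hy).eq_or_lt with heq | hlt
    · exact Eventually.of_forall fun N => by rw [heq]; gcongr; exact hm y hy heq
    · filter_upwards [eventually_ge_atTop ((m y - m x) / (l x - l y))] with N hN
      rw [div_le_iff₀ (sub_pos.2 hlt)] at hN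
      linarith
  obtain ⟨N, hN⟩ := ((Finset.eventually_all S).2 hvertex).exists
  have hhull : convexHull ℝ (S : Set V) ⊆ {y | (N • l + m) y ≤ N * l x + m x} :=
    convexHull_min hN (convex_halfSpace_le (N • l + m).toLinearMap.isLinear _)
  exact ⟨N, fun y hy => hhull hy⟩

/-- If `l` exposes `F` in the polytope and `m` exposes `G` in `F`, then `N • l + m` exposes `G` in
the polytope for every large `N`. -/
theorem isExposed_trans_of_convexHull {S : Finset V} {F G : Set V}
    (hF : IsExposed ℝ (convexHull ℝ (S : Set V)) F) (hG : IsExposed ℝ F G) :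
    IsExposed ℝ (convexHull ℝ (S : Set V)) G := by
  rintro ⟨x, hxG⟩
  obtain ⟨m, rfl⟩ := hG ⟨x, hxG⟩
  obtain ⟨l, rfl⟩ := hF ⟨x, hxG.1⟩
  obtain ⟨⟨hxC, hlx⟩, hmx⟩ := hxG
  have hSC := subset_convexHull ℝ (S : Set V)
  obtain ⟨N, hN⟩ := exists_forall_mul_add_le (m := m) (fun y hy => hlx y (hSC hy))
    fun y hy heq => hmx y ⟨hSC hy, fun z hz => (hlx z hz).trans heq.ge⟩
  refine ⟨(N + 1) • l + m, Set.ext fun y => ⟨?_, ?_⟩⟩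
  · rintro ⟨⟨hyC, hly⟩, hmy⟩
    refine ⟨hyC, fun z hz => ?_⟩
    have hNz := hN z hz
    have hlyx := hly x hxC
    have hmyx := hmy x ⟨hxC, hlx⟩
    have hlxy := hlx y hyC
    have hleq : l y = l x := le_antisymm hlxy hlyx
    simp only [add_apply, smul_apply, smul_eq_mul, hleq]
    linarith [hlx z hz]
  · rintro ⟨hyC, hy⟩
    have hyx := hy x hxC
    simp only [add_apply, smul_apply, smul_eq_mul] at hyx
    have hNy := hN y hyC
    have hleq : l y = l x := le_antisymm (hlx y hyC) (by linarith)
    rw [hleq] at hyx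
    exact ⟨⟨hyC, fun z hz => (hlx z hz).trans hleq.ge⟩,
      fun z hz => (hmx z hz).trans (by linarith)⟩

variable [IsTopologicalAddGroup V]

theorem mem_intrinsicInterior_iff_eventually {K : Set V} {p : V} (hp : p ∈ K) :
    p ∈ intrinsicInterior ℝ K ↔ ∀ᶠ v in 𝓝 (0 : V), v ∈ vectorSpan ℝ K → p + v ∈ K := by
  have hspan (v : V) : p + v ∈ affineSpan ℝ K ↔ v ∈ vectorSpan ℝ K := by
    rw [← AffineSubspace.vsub_right_mem_direction_iff_mem (mem_affineSpan ℝ hp),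
      direction_affineSpan, vsub_eq_sub, add_sub_cancel_left]
  have hmem : p ∈ intrinsicInterior ℝ K ↔ ∀ᶠ x in 𝓝 p, x ∈ affineSpan ℝ K → x ∈ K := by
    change _ ↔ ∀ᶠ x in 𝓝 p, x ∈ (affineSpan ℝ K : Set V) → x ∈ K
    rw [← eventually_nhdsWithin_iff,
      ← eventually_nhds_subtype_iff _ (⟨p, mem_affineSpan ℝ hp⟩ : affineSpan ℝ K),
      mem_intrinsicInterior]
    simp only [Subtype.exists, exists_and_right, exists_eq_right, mem_interior_iff_mem_nhds]
    exact ⟨fun ⟨_, h⟩ => h, fun h => ⟨mem_affineSpan ℝ hp, h⟩⟩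
  rw [hmem, ← map_add_left_nhds_zero p, eventually_map]
  simp only [hspan]

theorem eq_of_mem_intrinsicInterior_of_isExposed [ContinuousSMul ℝ V] {K G : Set V} {p : V}
    (hp : p ∈ intrinsicInterior ℝ K) (hG : IsExposed ℝ K G) (hpG : p ∈ G) : G = K := by
  have hpK := intrinsicInterior_subset hp
  rw [mem_intrinsicInterior_iff_eventually hpK] at hp
  obtain ⟨l, rfl⟩ := hG ⟨p, hpG⟩
  refine Set.Subset.antisymm (fun x hx => hx.1) fun y hy => ⟨hy, fun z hz => ?_⟩
  have hlim : Tendsto (fun ε : ℝ => -(ε • (y - p))) (𝓝[>] 0) (𝓝 0) :=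
    tendsto_nhdsWithin_of_tendsto_nhds
      (Continuous.tendsto' (by fun_prop) _ _ (by rw [zero_smul, neg_zero]))
  obtain ⟨ε, hε, hεpos⟩ := ((hlim.eventually hp).and self_mem_nhdsWithin).exists
  have hback := hpG.2 _ (hε (neg_mem (Submodule.smul_mem _ _ (vsub_mem_vectorSpan ℝ hy hpK))))
  simp only [map_add, map_neg, map_smul, map_sub, smul_eq_mul] at hback
  have hpy : l p ≤ l y := by
    by_contra! hlt
    nlinarith [mul_pos hεpos (sub_pos.2 hlt)]
  exact (hpG.2 z hz).trans hpy

theorem eventually_add_mem_of_nonneg [ContinuousSMul ℝ V] {A : Set V} (hA : Convex ℝ A) {p q : V}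
    {W : Submodule ℝ V} (hW : ∀ᶠ w in 𝓝 (0 : V), w ∈ W → p + w ∈ A) (hq : q ∈ A)
    (μ : StrongDual ℝ V) :
    ∀ᶠ w in 𝓝 (0 : V), 0 ≤ μ w → w - μ w • (q - p) ∈ W → p + w ∈ A := by
  have hlim : Tendsto (fun w => (1 - μ w)⁻¹ • (w - μ w • (q - p))) (𝓝 0) (𝓝 0) := by
    have hμ : Tendsto (fun w => μ w) (𝓝 0) (𝓝 0) := by simpa using μ.continuous.tendsto 0
    simpa using ((hμ.const_sub 1).inv₀ (by norm_num)).smul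
      (tendsto_id.sub (hμ.smul_const (q - p)))
  have hlt : ∀ᶠ w in 𝓝 (0 : V), μ w < 1 :=
    (isOpen_lt μ.continuous continuous_const).mem_nhds (by simp)
  filter_upwards [hlim.eventually hW, hlt] with w hw hlt hμw hwW
  have hne : 1 - μ w ≠ 0 := (sub_pos.2 hlt).ne'
  have hcomb := hA (hw (W.smul_mem _ hwW)) hq (sub_nonneg.2 hlt.le) hμw (by ring)
  rw [smul_add, smul_inv_smul₀ hne] at hcomb
  convert hcomb using 1
  module

end TopologicalVectorSpace

section FiniteDimensional

variable {V : Type*} [NormedAddCommGroup V] [NormedSpace ℝ V] [FiniteDimensional ℝ V]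

theorem exists_supporting_functional {K : Set V} (hK : Convex ℝ K) {p : V} (hp : p ∈ K)
    (hpK : p ∉ intrinsicInterior ℝ K) :
    ∃ l : StrongDual ℝ V, (∀ y ∈ K, l y ≤ l p) ∧ ∃ z ∈ K, l z < l p := by
  set W := vectorSpan ℝ K
  have hsub {y : V} (hy : y ∈ K) : y - p ∈ W := vsub_mem_vectorSpan ℝ hy hp
  let K' : Set W := {w | p + (w : V) ∈ K}
  have hK' : Convex ℝ K' := (hK.translate_preimage_right p).linear_preimage W.subtype
  have hint (w : W) (hw : p + (w : V) ∈ K) :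
      w ∈ interior K' ↔ p + (w : V) ∈ intrinsicInterior ℝ K := by
    rw [mem_intrinsicInterior_iff_eventually hw, mem_interior_iff_mem_nhds,
      ← map_add_left_nhds_zero w]
    change (∀ᶠ v : W in 𝓝 0, p + ((w + v : W) : V) ∈ K) ↔ ∀ᶠ v in 𝓝 (0 : V), v ∈ (W : Set V) → _
    rw [← eventually_nhdsWithin_iff, ← W.coe_zero, ← eventually_nhds_subtype_iff]
    simp only [Submodule.coe_add, add_assoc]
    rfl
  obtain ⟨z, hz⟩ := Set.Nonempty.intrinsicInterior hK ⟨p, hp⟩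
  have hzK := intrinsicInterior_subset hz
  have hz' : (⟨z - p, hsub hzK⟩ : W) ∈ interior K' := by
    rw [hint _ (by simpa using hzK)]
    simpa using hz
  obtain ⟨f, hf⟩ := geometric_hahn_banach_open_point hK'.interior isOpen_interior
    (x := 0) (by rw [hint 0 (by simpa using hp)]; simpa using hpK)
  rw [map_zero] at hf
  have hfK' : ∀ w ∈ K', f w ≤ 0 := by
    intro w hw
    refine closure_minimal (fun v hv => (hf v hv).le)
      (isClosed_le f.continuous continuous_const) ?_
    rw [hK'.closure_interior_eq_closure_of_nonempty_interior ⟨_, hz'⟩]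
    exact subset_closure hw
  obtain ⟨l, hl, -⟩ := exists_extension_norm_eq W f
  refine ⟨l, fun y hy => ?_, z, hzK, ?_⟩
  · rw [← sub_nonpos, ← map_sub]
    exact (hl ⟨y - p, hsub hy⟩).trans_le (hfK' _ (by simpa [K'] using hy))
  · rw [← sub_neg, ← map_sub]
    exact (hl ⟨z - p, hsub hzK⟩).trans_lt (hf _ hz')

theorem mem_intrinsicInterior_of_forall_isExposed {K : Set V} (hK : Convex ℝ K) {p : V}
    (hp : p ∈ K) (h : ∀ G, IsExposed ℝ K G → p ∈ G → G = K) : p ∈ intrinsicInterior ℝ K := by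
  by_contra hpK
  obtain ⟨l, hl, z, hz, hlt⟩ := exists_supporting_functional hK hp hpK
  have hzl : z ∈ l.toExposed K :=
    (h _ ContinuousLinearMap.toExposed.isExposed ⟨hp, hl⟩).symm ▸ hz
  exact hlt.not_ge (hzl.2 p hp)

end FiniteDimensional

theorem affineSpan_ne_top_of_finrank_lt {V : Type*} [AddCommGroup V] [Module ℝ V] {S : Set V}
    (h : Module.finrank ℝ (vectorSpan ℝ S) < Module.finrank ℝ V) : affineSpan ℝ S ≠ ⊤ := by
  intro htop
  rw [← direction_affineSpan, htop, AffineSubspace.direction_top, finrank_top] at h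
  exact lt_irrefl _ h

section FiniteDimensional

variable {V : Type*} [NormedAddCommGroup V] [NormedSpace ℝ V] [FiniteDimensional ℝ V]

theorem dense_setOf_forall_notMem_affineSubspace {ι : Type*} {s : Set ι} (hs : s.Countable)
    {A : ι → AffineSubspace ℝ V} (hA : ∀ i ∈ s, A i ≠ ⊤) : Dense {x | ∀ i ∈ s, x ∉ A i} := by
  have hdense := dense_biInter_of_isOpen (f := fun i => (A i : Set V)ᶜ)
    (fun i _ => (A i).closed_of_finiteDimensional.isOpen_compl) hs fun i hi => by
      rw [← interior_eq_empty_iff_dense_compl, ← Set.not_nonempty_iff_eq_empty]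
      intro hne
      refine hA i hi (top_le_iff.1 ?_)
      rw [← isOpen_interior.affineSpan_eq_top hne, affineSpan_le]
      exact interior_subset
  convert hdense using 1
  ext x
  simp

end FiniteDimensional

/-! ### Faces of polytopes -/

section Faces

variable {d : ℕ} {C F G K : Set (E d)}

theorem IsFullPolytope.convex (hC : IsFullPolytope C) : Convex ℝ C := by
  obtain ⟨⟨S, rfl⟩, -⟩ := hC
  exact convex_convexHull ℝ _

theorem IsFullPolytope.isClosed (hC : IsFullPolytope C) : IsClosed C :=
  hC.isCompact.isClosed

theorem IsFullPolytope.nonempty (hC : IsFullPolytope C) : C.Nonempty :=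
  hC.2.mono interior_subset

theorem IsFullPolytope.closure_interior (hC : IsFullPolytope C) : closure (interior C) = C := by
  rw [hC.convex.closure_interior_eq_closure_of_nonempty_interior hC.2, hC.isClosed.closure_eq]

theorem IsFullPolytope.vectorSpan_eq_top (hC : IsFullPolytope C) : vectorSpan ℝ C = ⊤ := by
  have hspan : affineSpan ℝ C = ⊤ := by
    refine top_le_iff.1 ?_
    rw [← isOpen_interior.affineSpan_eq_top hC.2]
    exact affineSpan_mono ℝ interior_subset
  rw [← direction_affineSpan, hspan, AffineSubspace.direction_top]

theorem IsFullPolytope.dim_eq (hC : IsFullPolytope C) : dim C = d := by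
  rw [dim, hC.vectorSpan_eq_top, finrank_top, finrank_euclideanSpace_fin]

theorem IsFace.subset (hF : IsFace C F) : F ⊆ C := hF.2.subset

theorem IsFace.convex (hF : IsFace C F) (hC : Convex ℝ C) : Convex ℝ F := hF.2.convex hC

theorem IsFace.isCompact (hF : IsFace C F) (hC : IsFullPolytope C) : IsCompact F :=
  hF.2.isCompact hC.isCompact

theorem IsFullPolytope.finite_setOf_isFace (hC : IsFullPolytope C) : {F | IsFace C F}.Finite := by
  have hcompact := hC.isCompact
  have hconvex := hC.convex
  obtain ⟨⟨S, rfl⟩, -⟩ := hC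
  refine (S.finite_toSet.finite_subsets.image fun A => closure (convexHull ℝ A)).subset
    fun F hF => ⟨F.extremePoints ℝ, ?_, ?_⟩
  · exact hF.2.isExtreme.extremePoints_subset_extremePoints.trans extremePoints_convexHull_subset
  · exact closure_convexHull_extremePoints (hF.2.isCompact hcompact) (hF.2.convex hconvex)

theorem IsFace.trans (hC : IsFullPolytope C) (hF : IsFace C F) (hG : IsFace F G) :
    IsFace C G := by
  obtain ⟨⟨S, rfl⟩, -⟩ := hC
  exact ⟨hG.1, isExposed_trans_of_convexHull hF.2 hG.2⟩

theorem IsFace.inter (hF : IsFace C F) (hG : IsFace C G) (h : (F ∩ G).Nonempty) :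
    IsFace C (F ∩ G) :=
  ⟨h, hF.2.inter hG.2⟩

theorem IsFace.of_subset (hG : IsFace C G) (hGF : G ⊆ F) (hFC : F ⊆ C) : IsFace F G :=
  ⟨hG.1, hG.2.mono hFC hGF⟩

theorem IsFace.exists_functional (hG : IsFace K G) :
    ∃ l : StrongDual ℝ (E d), (∀ v ∈ vectorSpan ℝ G, l v = 0) ∧
      ∀ g ∈ G, ∀ x ∈ K, x ∉ G → l (x - g) < 0 := by
  obtain ⟨hne, hexp⟩ := hG
  obtain ⟨l, rfl⟩ := hexp hne
  refine ⟨l, fun v hv => ?_, fun g hg x hx hxG => ?_⟩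
  · suffices vectorSpan ℝ _ ≤ LinearMap.ker l.toLinearMap from this hv
    rw [vectorSpan, Submodule.span_le]
    rintro _ ⟨x, hx, y, hy, rfl⟩
    exact (map_sub l x y).trans (sub_eq_zero.2 ((hy.2 x hx.1).antisymm (hx.2 y hy.1)))
  · rw [map_sub, sub_neg]
    by_contra! hle
    exact hxG ⟨hx, fun y hy => (hg.2 y hy).trans hle⟩

theorem IsFace.exists_mem_notMem (hG : IsFace K G) (hne : G ≠ K) : ∃ x ∈ K, x ∉ G := by
  by_contra! h
  exact hne (hG.subset.antisymm h)

theorem IsFace.dim_lt (hG : IsFace K G) (hne : G ≠ K) : dim G < dim K := by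
  obtain ⟨l, hl0, hlneg⟩ := hG.exists_functional
  obtain ⟨x, hx, hxG⟩ := hG.exists_mem_notMem hne
  obtain ⟨g, hg⟩ := hG.1
  refine Submodule.finrank_lt_finrank_of_lt ((vectorSpan_mono ℝ hG.subset).lt_of_ne fun heq => ?_)
  have hxg : x - g ∈ vectorSpan ℝ G := heq ▸ vsub_mem_vectorSpan ℝ hx (hG.subset hg)
  exact (hlneg g hg x hx hxG).ne (hl0 _ hxg)

theorem IsFace.dim_lt_of_ne (hC : IsFullPolytope C) (hG : IsFace C G) (hne : G ≠ C) :
    dim G < d :=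
  (hG.dim_lt hne).trans_eq hC.dim_eq

theorem IsFacet.ne (hC : IsFullPolytope C) (hF : IsFacet C F) : F ≠ C := by
  rintro rfl
  exact (Nat.lt_of_succ_le hF.2.le).ne hC.dim_eq

theorem IsFace.notMem_interior (hF : IsFace C F) (hne : F ≠ C) {x : E d} (hx : x ∈ F) :
    x ∉ interior C :=
  fun h => hne <|
    eq_of_mem_intrinsicInterior_of_isExposed (interior_subset_intrinsicInterior h) hF.2 hx

end Faces

/-! ### Outer normals -/

section OuterNormal

variable {d : ℕ} {C F : Set (E d)} {n m : E d}

/-- `F` spans a hyperplane and `n` is one of the two unit normals to it. Unlike `IsUnitNormal`, this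
determines `n` up to sign. -/
structure IsHyperplaneNormal (F : Set (E d)) (n : E d) : Prop where
  norm_eq_one : ‖n‖ = 1
  mem_vectorSpan_iff : ∀ v, v ∈ vectorSpan ℝ F ↔ ⟪n, v⟫_ℝ = 0

namespace IsHyperplaneNormal

theorem inner_self (hn : IsHyperplaneNormal F n) : ⟪n, n⟫_ℝ = 1 := by
  rw [real_inner_self_eq_norm_sq, hn.norm_eq_one, one_pow]

theorem neg (hn : IsHyperplaneNormal F n) : IsHyperplaneNormal F (-n) :=
  ⟨by rw [norm_neg, hn.norm_eq_one],
    fun v => by rw [hn.mem_vectorSpan_iff, inner_neg_left, neg_eq_zero]⟩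

theorem isUnitNormal (hn : IsHyperplaneNormal F n) : IsUnitNormal F n :=
  ⟨hn.norm_eq_one, fun w hw => (hn.mem_vectorSpan_iff w).1 hw⟩

theorem inner_sub_eq_zero (hn : IsHyperplaneNormal F n) {y z : E d} (hy : y ∈ F) (hz : z ∈ F) :
    ⟪n, y - z⟫_ℝ = 0 :=
  (hn.mem_vectorSpan_iff _).1 (vsub_mem_vectorSpan ℝ hy hz)

theorem inner_sub_eq (hn : IsHyperplaneNormal F n) {y z : E d} (hy : y ∈ F) (hz : z ∈ F)
    (x : E d) : ⟪n, y - x⟫_ℝ = ⟪n, z - x⟫_ℝ := by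
  rw [← sub_add_sub_cancel y z x, inner_add_right, hn.inner_sub_eq_zero hy hz, zero_add]

theorem eq_or_eq_neg (hn : IsHyperplaneNormal F n) (hm : IsUnitNormal F m) : m = n ∨ m = -n := by
  set c := ⟪n, m⟫_ℝ
  have hspan : m - c • n ∈ vectorSpan ℝ F := by
    rw [hn.mem_vectorSpan_iff, inner_sub_right, real_inner_smul_right, hn.inner_self, mul_one,
      sub_self]
  have hmc : m = c • n := by
    rw [← sub_eq_zero, ← inner_self_eq_zero (𝕜 := ℝ)]
    nth_rewrite 1 [inner_sub_left]
    rw [hm.2 _ hspan, real_inner_smul_left, (hn.mem_vectorSpan_iff _).1 hspan, mul_zero, sub_self]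
  have hc : |c| = 1 := by
    rw [← hm.1, hmc, norm_smul, hn.norm_eq_one, mul_one, Real.norm_eq_abs]
  rcases eq_or_eq_neg_of_abs_eq hc with h | h
  · left; rw [hmc, h, one_smul]
  · right; rw [hmc, h, neg_smul, one_smul]

end IsHyperplaneNormal

/-- `n` is the unit outer normal of `C` along its hyperface `F`. -/
structure IsOuterNormal (C F : Set (E d)) (n : E d) : Prop extends IsHyperplaneNormal F n where
  inner_sub_neg : ∀ z ∈ F, ∀ y ∈ C, y ∉ F → ⟪n, y - z⟫_ℝ < 0

theorem IsFacet.exists_isOuterNormal (hC : IsFullPolytope C) (hF : IsFacet C F) :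
    ∃ n, IsOuterNormal C F n := by
  obtain ⟨l, hl0, hlneg⟩ := hF.1.exists_functional
  obtain ⟨x, hx, hxF⟩ := hF.1.exists_mem_notMem (hF.ne hC)
  obtain ⟨g, hg⟩ := hF.1.1
  have hlx := hlneg g hg x hx hxF
  have hl : l ≠ 0 := by
    rintro rfl
    exact lt_irrefl _ hlx
  have hspan : vectorSpan ℝ F = LinearMap.ker l.toLinearMap := by
    refine Submodule.eq_of_le_of_finrank_le (fun v hv => hl0 v hv) ?_
    have hlt := Submodule.finrank_lt (s := LinearMap.ker l.toLinearMap) fun h =>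
      hlx.ne (LinearMap.congr_fun (LinearMap.ker_eq_top.1 h) _)
    rw [finrank_euclideanSpace_fin] at hlt
    have hdim : Module.finrank ℝ (vectorSpan ℝ F) + 1 = d := hF.2
    omega
  set w := (InnerProductSpace.toDual ℝ (E d)).symm l
  have hw : 0 < ‖w‖ := norm_pos_iff.2 (by simpa [w] using hl)
  have hinner (v : E d) : ⟪‖w‖⁻¹ • w, v⟫_ℝ = ‖w‖⁻¹ * l v := by
    rw [real_inner_smul_left, InnerProductSpace.toDual_symm_apply]
  refine ⟨‖w‖⁻¹ • w, ⟨norm_smul_inv_norm (𝕜 := ℝ) (norm_pos_iff.1 hw), fun v => ?_⟩,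
    fun z hz y hy hyF => ?_⟩
  · rw [hinner, hspan, LinearMap.mem_ker, mul_eq_zero_iff_left (inv_pos.2 hw).ne']
    rfl
  · rw [hinner]
    exact mul_neg_of_pos_of_neg (inv_pos.2 hw) (hlneg z hz y hy hyF)

namespace IsOuterNormal

theorem inner_sub_nonpos (hn : IsOuterNormal C F n) {y z : E d} (hz : z ∈ F) (hy : y ∈ C) :
    ⟪n, y - z⟫_ℝ ≤ 0 := by
  by_cases hyF : y ∈ F
  · exact (hn.inner_sub_eq_zero hyF hz).le
  · exact (hn.inner_sub_neg z hz y hy hyF).le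

theorem eventually_mem (hn : IsOuterNormal C F n) (hC : IsFullPolytope C) (hF : IsFacet C F)
    {z : E d} (hz : z ∈ intrinsicInterior ℝ F) : ∀ᶠ y in 𝓝 z, ⟪n, y - z⟫_ℝ ≤ 0 → y ∈ C := by
  obtain ⟨q, hq, hqF⟩ := hF.1.exists_mem_notMem (hF.ne hC)
  have hzF := intrinsicInterior_subset hz
  rw [mem_intrinsicInterior_iff_eventually hzF] at hz
  have hneg := hn.inner_sub_neg z hzF q hq hqF
  have hcone := eventually_add_mem_of_nonneg hC.convex
    (hz.mono fun v hv hvF => hF.1.subset (hv hvF)) hq ((⟪n, q - z⟫_ℝ)⁻¹ • innerSL ℝ n)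
  rw [← map_add_left_nhds_zero z, eventually_map]
  filter_upwards [hcone] with v hv hle
  rw [add_sub_cancel_left] at hle
  refine hv ?_ ?_
  · exact mul_nonneg_of_nonpos_of_nonpos (inv_nonpos.2 hneg.le) hle
  · rw [hn.mem_vectorSpan_iff, inner_sub_right, real_inner_smul_right]
    simp only [smul_apply, innerSL_apply_apply, smul_eq_mul]
    field_simp [hneg.ne]
    ring

theorem eventually_mem_interior (hn : IsOuterNormal C F n) (hC : IsFullPolytope C)
    (hF : IsFacet C F) {z : E d} (hz : z ∈ intrinsicInterior ℝ F) :
    ∀ᶠ y in 𝓝 z, ⟪n, y - z⟫_ℝ < 0 → y ∈ interior C := by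
  filter_upwards [(hn.eventually_mem hC hF hz).eventually_nhds] with y hy hneg
  have hopen : ∀ᶠ x in 𝓝 y, ⟪n, x - z⟫_ℝ < 0 :=
    (isOpen_lt (by fun_prop) continuous_const).mem_nhds hneg
  rw [mem_interior_iff_mem_nhds]
  filter_upwards [hy, hopen] with x hx hneg using hx hneg.le

theorem inner_sub_neg_of_mem_interior (hn : IsOuterNormal C F n) (hC : IsFullPolytope C)
    (hF : IsFacet C F) {y z : E d} (hz : z ∈ F) (hy : y ∈ interior C) : ⟪n, y - z⟫_ℝ < 0 :=
  hn.inner_sub_neg z hz y (interior_subset hy) fun hyF => hF.1.notMem_interior (hF.ne hC) hyF hy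

end IsOuterNormal

theorem IsUnitNormalFromTo.isOuterNormal {D : Set (E d)} (hC : IsFullPolytope C)
    (hadj : Adjacent C D) (hn : IsUnitNormalFromTo C D n) : IsOuterNormal C (C ∩ D) n := by
  obtain ⟨m, hm⟩ := hadj.1.exists_isOuterNormal hC
  rcases hm.eq_or_eq_neg hn.1 with rfl | rfl
  · exact hm
  · obtain ⟨y, hy, hyF⟩ := hadj.1.1.exists_mem_notMem (hadj.1.ne hC)
    obtain ⟨z, hz⟩ := hadj.1.1.1
    have hneg := hm.inner_sub_neg z hz y hy hyF
    have hnonpos := (hn.2 z hz).1 y hy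
    rw [inner_neg_left] at hnonpos
    linarith

end OuterNormal

/-! ### Locally finite normal tilings -/

theorem locallyFinite_vadd_of_pairwise_disjoint {V ι : Type*} [NormedAddCommGroup V]
    [ProperSpace V] {t : ι → V} {K U : Set V} (hK : Bornology.IsBounded K) (hU : IsOpen U)
    (hne : U.Nonempty) (hdisj : Pairwise fun i j => Disjoint (t i +ᵥ U) (t j +ᵥ U)) :
    LocallyFinite fun i => t i +ᵥ K := by
  obtain ⟨u, hu⟩ := hne
  obtain ⟨δ, hδ, hball⟩ := Metric.isOpen_iff.1 hU u hu
  have hsep : Pairwise fun i j => δ ≤ dist (t i) (t j) := by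
    intro i j hij
    by_contra! hlt
    refine Set.disjoint_left.1 (hdisj hij) ⟨u, hu, rfl⟩ ⟨t i - t j + u, hball ?_, ?_⟩
    · simpa [dist_eq_norm] using hlt
    · simp only [vadd_eq_add]
      abel
  let : TopologicalSpace ι := ⊥
  have : DiscreteTopology ι := ⟨rfl⟩
  have hcofinite := (Metric.isClosedEmbedding_of_pairwise_le_dist hδ hsep).tendsto_cocompact
  rw [cocompact_eq_cofinite] at hcofinite
  intro x
  refine ⟨Metric.ball x 1, Metric.ball_mem_nhds x one_pos, ?_⟩
  have hfin : (t ⁻¹' (Metric.ball x 1 - K)).Finite := by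
    have hcompact := (Metric.isBounded_ball.sub hK : Bornology.IsBounded (Metric.ball x 1 - K))
      |>.isCompact_closure
    refine Set.Finite.subset ?_ (Set.preimage_mono subset_closure)
    simpa using hcofinite hcompact.compl_mem_cocompact
  refine hfin.subset ?_
  rintro i ⟨_, ⟨k, hk, rfl⟩, hik⟩
  exact ⟨t i + k, hik, k, hk, add_sub_cancel_right _ _⟩

section Tiling

variable {d : ℕ} {P : Set (E d)} {T : Set (Set (E d))} {C D F G K : Set (E d)} {n x : E d}

/-- A normal tiling whose cells form a locally finite family: the setting in which a canonical
scaling is integrated to a piecewise affine function. -/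
structure IsLocallyFiniteTiling (T : Set (Set (E d))) : Prop extends IsNormalTiling T where
  locallyFinite : LocallyFinite (Subtype.val : T → Set (E d))

theorem IsParallelohedralTiling.exists_vadd_eq (hT : IsParallelohedralTiling P T) (hC : C ∈ T)
    (hD : D ∈ T) : ∃ t : E d, D = t +ᵥ C := by
  obtain ⟨t, rfl⟩ := hT.translates C hC
  obtain ⟨u, rfl⟩ := hT.translates D hD
  exact ⟨u - t, by rw [vadd_vadd, sub_add_cancel]⟩

theorem IsParallelohedralTiling.isLocallyFiniteTiling (hT : IsParallelohedralTiling P T) :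
    IsLocallyFiniteTiling T := by
  refine ⟨hT.tiling, ?_⟩
  rcases T.eq_empty_or_nonempty with rfl | ⟨C, hC⟩
  · exact locallyFinite_of_finite _
  choose t ht using fun D : T => hT.exists_vadd_eq hC D.2
  have hCp := hT.tiling.polytope C hC
  rw [funext ht]
  refine locallyFinite_vadd_of_pairwise_disjoint hCp.isCompact.isBounded isOpen_interior hCp.2 ?_
  intro D D' hne
  simp only [← interior_vadd, ← ht]
  exact hT.tiling.disjoint_interior D.2 D'.2 (Subtype.coe_ne_coe.2 hne)

namespace IsNormalTiling

theorem eq_of_mem_interior (hT : IsNormalTiling T) (hC : C ∈ T) (hD : D ∈ T)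
    (hx : x ∈ interior C) (hxD : x ∈ D) : C = D := by
  by_contra hne
  rw [← (hT.polytope D hD).closure_interior] at hxD
  obtain ⟨y, hyC, hyD⟩ := mem_closure_iff.1 hxD _ isOpen_interior hx
  exact Set.disjoint_left.1 (hT.disjoint_interior hC hD hne) hyC hyD

theorem isFace_inter (hT : IsNormalTiling T) (hC : C ∈ T) (hD : D ∈ T) (hne : C ≠ D)
    (h : (C ∩ D).Nonempty) : IsFace C (C ∩ D) ∧ IsFace D (C ∩ D) :=
  (hT.face_to_face hC hD hne).resolve_left h.ne_empty

theorem inter_ne (hT : IsNormalTiling T) (hC : C ∈ T) (hD : D ∈ T) (hne : C ≠ D) : C ∩ D ≠ C := by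
  intro h
  obtain ⟨x, hx⟩ := (hT.polytope C hC).2
  exact hne (hT.eq_of_mem_interior hC hD hx (Set.inter_eq_left.1 h (interior_subset hx)))

theorem isClosed_of_mem_facets (hT : IsNormalTiling T) (hF : F ∈ facets T) : IsClosed F := by
  obtain ⟨C, hC, hF⟩ := hF
  exact (hF.1.isCompact (hT.polytope C hC)).isClosed

end IsNormalTiling

namespace IsLocallyFiniteTiling

theorem isClosed_sUnion (hT : IsLocallyFiniteTiling T) {T' : Set (Set (E d))} (hT' : T' ⊆ T) :
    IsClosed (⋃₀ T') := by
  rw [Set.sUnion_eq_iUnion]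
  exact (hT.locallyFinite.comp_injective (Set.inclusion_injective hT')).isClosed_iUnion
    fun C => (hT.polytope C (hT' C.2)).isClosed

theorem countable (hT : IsLocallyFiniteTiling T) : T.Countable := by
  have huniv := hT.locallyFinite.countable_univ fun C => (hT.polytope C C.2).nonempty
  exact Set.countable_coe_iff.1 (Set.countable_univ_iff.1 huniv)

theorem finite_cells_inter_nonempty (hT : IsLocallyFiniteTiling T) {B : Set (E d)}
    (hB : IsCompact B) : {C ∈ T | (C ∩ B).Nonempty}.Finite := by
  refine ((hT.locallyFinite.finite_nonempty_inter_compact hB).image Subtype.val).subset ?_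
  rintro C ⟨hC, hCB⟩
  exact ⟨⟨C, hC⟩, hCB, rfl⟩

theorem finite_facets_inter_nonempty (hT : IsLocallyFiniteTiling T) {B : Set (E d)}
    (hB : IsCompact B) : {F ∈ facets T | (F ∩ B).Nonempty}.Finite := by
  refine ((hT.finite_cells_inter_nonempty hB).biUnion fun C hC =>
    (hT.polytope C hC.1).finite_setOf_isFace).subset ?_
  rintro F ⟨⟨C, hC, hF⟩, hFB⟩
  exact Set.mem_biUnion ⟨hC, hFB.mono (Set.inter_subset_inter_left _ hF.1.subset)⟩ hF.1

end IsLocallyFiniteTiling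

/-! ### Skeletons of a tiling -/

/-- The faces of the cells of codimension at least `j`. -/
def facesOfCodimGE (T : Set (Set (E d))) (j : ℕ) : Set (Set (E d)) :=
  {K | ∃ C ∈ T, IsFace C K ∧ dim K + j ≤ d}

/-- The skeleton of codimension `j`: the union of the faces of codimension at least `j`. -/
def codimSkeleton (T : Set (Set (E d))) (j : ℕ) : Set (E d) :=
  ⋃₀ facesOfCodimGE T j

theorem IsFace.mem_codimSkeleton (hC : C ∈ T) (hK : IsFace C K) {j : ℕ} (hj : dim K + j ≤ d)
    (hx : x ∈ K) : x ∈ codimSkeleton T j :=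
  ⟨K, ⟨C, hC, hK, hj⟩, hx⟩

theorem facets_subset_facesOfCodimGE : facets T ⊆ facesOfCodimGE T 1 :=
  fun _ ⟨C, hC, hF⟩ => ⟨C, hC, hF.1, hF.2.le⟩

theorem codimSkeleton_anti : Antitone (codimSkeleton T) := by
  rintro i j hij x ⟨K, ⟨C, hC, hK, hj⟩, hx⟩
  exact hK.mem_codimSkeleton hC (by omega) hx

theorem IsLocallyFiniteTiling.countable_facesOfCodimGE (hT : IsLocallyFiniteTiling T) (j : ℕ) :
    (facesOfCodimGE T j).Countable := by
  refine (hT.countable.biUnion fun C hC =>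
    (hT.polytope C hC).finite_setOf_isFace.countable).mono ?_
  rintro K ⟨C, hC, hK, -⟩
  exact Set.mem_biUnion hC hK

theorem IsNormalTiling.notMem_codimSkeleton (hT : IsNormalTiling T) (hC : C ∈ T)
    (hx : x ∈ interior C) {j : ℕ} (hj : j ≠ 0) : x ∉ codimSkeleton T j := by
  rintro ⟨K, ⟨D, hD, hK, hdim⟩, hxK⟩
  obtain rfl := hT.eq_of_mem_interior hC hD hx (hK.subset hxK)
  refine hK.notMem_interior ?_ hxK hx
  rintro rfl
  have := (hT.polytope K hC).dim_eq
  omega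

theorem IsFace.mem_intrinsicInterior (hC : C ∈ T) (hCp : IsFullPolytope C) (hK : IsFace C K)
    {j : ℕ} (hj : dim K + j ≤ d + 1) (hx : x ∈ K) (hxj : x ∉ codimSkeleton T j) :
    x ∈ intrinsicInterior ℝ K := by
  refine mem_intrinsicInterior_of_forall_isExposed (hK.convex hCp.convex) hx fun G hG hxG => ?_
  by_contra hne
  have hGK : IsFace K G := ⟨⟨x, hxG⟩, hG⟩
  have hlt := hGK.dim_lt hne
  exact hxj ((hK.trans hCp hGK).mem_codimSkeleton hC (by omega) hxG)

theorem IsNormalTiling.mem_intrinsicInterior_of_mem_facets (hT : IsNormalTiling T)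
    (hF : F ∈ facets T) (hx : x ∈ F) (hxs : x ∉ codimSkeleton T 2) :
    x ∈ intrinsicInterior ℝ F := by
  obtain ⟨C, hC, hF⟩ := hF
  exact hF.1.mem_intrinsicInterior hC (hT.polytope C hC) (by have := hF.2; omega) hx hxs

theorem IsFace.subset_of_mem (hC : C ∈ T) (hK : IsFace C K) (hG : IsFace C G) {j : ℕ}
    (hj : dim K + j ≤ d + 1) (hxK : x ∈ K) (hxG : x ∈ G) (hxj : x ∉ codimSkeleton T j) :
    K ⊆ G := by
  have hface := hK.inter hG ⟨x, hxK, hxG⟩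
  rw [← Set.inter_eq_left]
  by_contra hne
  have hlt := (hface.of_subset Set.inter_subset_left hK.subset).dim_lt hne
  exact hxj (hface.mem_codimSkeleton hC (by omega) ⟨hxK, hxG⟩)

theorem IsFacet.eq_of_mem (hC : C ∈ T) (hF : IsFacet C F) (hG : IsFacet C G) (hxF : x ∈ F)
    (hxG : x ∈ G) (hxs : x ∉ codimSkeleton T 2) : F = G :=
  (hF.1.subset_of_mem hC hG.1 (by have := hF.2; omega) hxF hxG hxs).antisymm
    (hG.1.subset_of_mem hC hF.1 (by have := hG.2; omega) hxG hxF hxs)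

/-! ### Adjacent cells -/

theorem Adjacent.symm (h : Adjacent C D) : Adjacent D C := by
  rw [Adjacent, Set.inter_comm D C]
  exact And.symm h

theorem Adjacent.ne (hC : IsFullPolytope C) (h : Adjacent C D) : C ≠ D := by
  rintro rfl
  exact h.1.ne hC (Set.inter_self C)

theorem IsLocallyFiniteTiling.exists_adjacent (hT : IsLocallyFiniteTiling T) (hC : C ∈ T)
    (hx : x ∈ C) (hxi : x ∉ interior C) (hxs : x ∉ codimSkeleton T 2) :
    ∃ D ∈ T, x ∈ D ∧ Adjacent C D := by
  have hcl : x ∈ ⋃₀ (T \ {C}) := by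
    have hxc : x ∈ closure Cᶜ := by rwa [closure_compl, Set.mem_compl_iff]
    refine closure_minimal (fun y hy => ?_) (hT.isClosed_sUnion Set.sdiff_subset) hxc
    obtain ⟨D, hD, hyD⟩ : y ∈ ⋃₀ T := hT.cover ▸ Set.mem_univ y
    exact ⟨D, ⟨hD, fun h => hy (h ▸ hyD)⟩, hyD⟩
  obtain ⟨D, ⟨hD, hDC⟩, hxD⟩ := hcl
  have hne : C ≠ D := fun h => hDC h.symm
  obtain ⟨hfaceC, hfaceD⟩ := hT.isFace_inter hC hD hne ⟨x, hx, hxD⟩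
  have hlt := hfaceC.dim_lt_of_ne (hT.polytope C hC) (hT.inter_ne hC hD hne)
  have hdim : dim (C ∩ D) + 1 = d := by
    by_contra h
    exact hxs (hfaceC.mem_codimSkeleton hC (by omega) ⟨hx, hxD⟩)
  exact ⟨D, hD, hxD, ⟨hfaceC, hdim⟩, ⟨hfaceD, hdim⟩⟩

theorem IsFacet.exists_adjacent (hT : IsLocallyFiniteTiling T) (hC : C ∈ T) (hF : IsFacet C F)
    (hx : x ∈ F) (hxs : x ∉ codimSkeleton T 2) : ∃ D ∈ T, C ∩ D = F ∧ Adjacent C D := by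
  have hxC := hF.1.subset hx
  obtain ⟨D, hD, hxD, hadj⟩ := hT.exists_adjacent hC hxC
    (hF.1.notMem_interior (hF.ne (hT.polytope C hC)) hx) hxs
  exact ⟨D, hD, hadj.1.eq_of_mem hC hF ⟨hxC, hxD⟩ hx hxs, hadj⟩

theorem IsNormalTiling.isOuterNormal_neg (hT : IsNormalTiling T) (hC : C ∈ T) (hD : D ∈ T)
    (hadj : Adjacent C D) (hn : IsOuterNormal C (C ∩ D) n) : IsOuterNormal D (C ∩ D) (-n) := by
  have hCp := hT.polytope C hC
  have hDp := hT.polytope D hD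
  obtain ⟨m, hm⟩ := hadj.2.exists_isOuterNormal hDp
  rcases hn.eq_or_eq_neg hm.isUnitNormal with rfl | rfl
  · obtain ⟨z, hz⟩ := Set.Nonempty.intrinsicInterior (hadj.1.1.convex hCp.convex) hadj.1.1.1
    have hlim : Tendsto (fun ε : ℝ => z - ε • m) (𝓝[>] 0) (𝓝 z) :=
      tendsto_nhdsWithin_of_tendsto_nhds (Continuous.tendsto' (by fun_prop) _ _ (by simp))
    obtain ⟨ε, ⟨hεC, hεD⟩, hε⟩ := ((hlim.eventually
      ((hn.eventually_mem_interior hCp hadj.1 hz).and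
        (hm.eventually_mem_interior hDp hadj.2 hz))).and self_mem_nhdsWithin).exists
    have hneg : ⟪m, z - ε • m - z⟫_ℝ < 0 := by
      rw [sub_sub_cancel_left, inner_neg_right, real_inner_smul_right, hm.inner_self, mul_one]
      exact neg_neg_of_pos hε
    exact (Set.disjoint_left.1 (hT.disjoint_interior hC hD (hadj.ne hCp)) (hεC hneg)
      (hεD hneg)).elim
  · exact hm

theorem IsNormalTiling.eventually_mem_of_adjacent (hT : IsNormalTiling T) (hC : C ∈ T)
    (hD : D ∈ T) (hadj : Adjacent C D) (hn : IsOuterNormal C (C ∩ D) n)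
    (hx : x ∈ intrinsicInterior ℝ (C ∩ D)) :
    ∀ᶠ y in 𝓝 x, (⟪n, y - x⟫_ℝ < 0 → y ∈ interior C) ∧
      (0 < ⟪n, y - x⟫_ℝ → y ∈ interior D) ∧ (⟪n, y - x⟫_ℝ = 0 → y ∈ C ∩ D) := by
  have hzero : ∀ᶠ y in 𝓝 x, ⟪n, y - x⟫_ℝ = 0 → y ∈ C ∩ D := by
    rw [← map_add_left_nhds_zero x, eventually_map]
    filter_upwards [(mem_intrinsicInterior_iff_eventually (intrinsicInterior_subset hx)).1 hx]
      with v hv h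
    rw [add_sub_cancel_left] at h
    exact hv ((hn.mem_vectorSpan_iff v).2 h)
  filter_upwards [hn.eventually_mem_interior (hT.polytope C hC) hadj.1 hx,
    (hT.isOuterNormal_neg hC hD hadj hn).eventually_mem_interior (hT.polytope D hD) hadj.2 hx,
    hzero] with y hyC hyD hy0
  refine ⟨hyC, fun hpos => hyD ?_, hy0⟩
  rwa [inner_neg_left, neg_lt_zero]

end Tiling

/-! ### General position -/

section GeneralPosition

variable {d : ℕ} {T : Set (Set (E d))} {K : Set (E d)} {a x y : E d}

/-- `x` is in general position with respect to `a` and the faces of codimension at least two: the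
line through `a` and `x` misses all these faces, except possibly at `a`. -/
def IsGenericFrom (T : Set (Set (E d))) (a x : E d) : Prop :=
  ∀ K ∈ facesOfCodimGE T 2, x ∉ affineSpan ℝ (insert a K)

theorem affineSpan_insert_ne_top (hK : K ∈ facesOfCodimGE T 2) (a : E d) :
    affineSpan ℝ (insert a K) ≠ ⊤ := by
  obtain ⟨C, -, -, hdim⟩ := hK
  refine affineSpan_ne_top_of_finrank_lt ((finrank_vectorSpan_insert_le_set ℝ K a).trans_lt ?_)
  rw [finrank_euclideanSpace_fin]
  exact hdim

theorem mem_of_add_smul_sub_mem {A : AffineSubspace ℝ (E d)} (ha : a ∈ A) {t : ℝ} (ht : t ≠ 0)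
    (h : a + t • (x - a) ∈ A) : x ∈ A := by
  have hx := AffineMap.lineMap_mem t⁻¹ ha h
  rwa [AffineMap.lineMap_apply, vsub_eq_sub, vadd_eq_add, add_sub_cancel_left,
    inv_smul_smul₀ ht, sub_add_cancel] at hx

theorem IsLocallyFiniteTiling.dense_setOf_isGenericFrom (hT : IsLocallyFiniteTiling T) (a : E d) :
    Dense {x | IsGenericFrom T a x} :=
  dense_setOf_forall_notMem_affineSubspace (hT.countable_facesOfCodimGE 2)
    fun _ hK => affineSpan_insert_ne_top hK a

namespace IsGenericFrom

theorem add_smul_sub (h : IsGenericFrom T a x) {t : ℝ} (ht : t ≠ 0) :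
    IsGenericFrom T a (a + t • (x - a)) :=
  fun K hK hmem => h K hK (mem_of_add_smul_sub_mem (mem_affineSpan ℝ (Set.mem_insert _ _)) ht hmem)

theorem notMem_codimSkeleton (h : IsGenericFrom T a x) : x ∉ codimSkeleton T 2 := by
  rintro ⟨K, hK, hx⟩
  exact h K hK (mem_affineSpan ℝ (Set.mem_insert_of_mem _ hx))

theorem notMem_codimSkeleton_of_mem_segment (h : IsGenericFrom T a x)
    (ha : a ∉ codimSkeleton T 2) (hy : y ∈ segment ℝ a x) : y ∉ codimSkeleton T 2 := by
  rw [segment_eq_image'] at hy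
  obtain ⟨t, -, rfl⟩ := hy
  rcases eq_or_ne t 0 with rfl | ht
  · simpa using ha
  · exact (h.add_smul_sub ht).notMem_codimSkeleton

end IsGenericFrom

theorem IsLocallyFiniteTiling.mem_interior_sUnion_of_forall_adjacent
    (hT : IsLocallyFiniteTiling T) {T' : Set (Set (E d))} (hT' : T' ⊆ T)
    (hadj : ∀ B ∈ T', ∀ D ∈ T, Adjacent B D → D ∈ T') (hx : x ∈ ⋃₀ T')
    (hxs : x ∉ codimSkeleton T 2) : x ∈ interior (⋃₀ T') := by
  obtain ⟨B, hB, hxB⟩ := hx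
  by_cases hxi : x ∈ interior B
  · exact interior_mono (Set.subset_sUnion_of_mem hB) hxi
  obtain ⟨D, hD, hxD, hBD⟩ := hT.exists_adjacent (hT' hB) hxB hxi hxs
  obtain ⟨n, hn⟩ := hBD.1.exists_isOuterNormal (hT.polytope B (hT' hB))
  rw [mem_interior_iff_mem_nhds]
  filter_upwards [hT.eventually_mem_of_adjacent (hT' hB) hD hBD hn
    (hT.mem_intrinsicInterior_of_mem_facets ⟨B, hT' hB, hBD.1⟩ ⟨hxB, hxD⟩ hxs)]
    with z ⟨hneg, hpos, hzero⟩
  rcases lt_trichotomy ⟪n, z - x⟫_ℝ 0 with h | h | h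
  · exact ⟨B, hB, interior_subset (hneg h)⟩
  · exact ⟨B, hB, (hzero h).1⟩
  · exact ⟨D, hadj B hB D hD hBD, interior_subset (hpos h)⟩

theorem IsLocallyFiniteTiling.eq_of_forall_adjacent_mem (hT : IsLocallyFiniteTiling T)
    {T' : Set (Set (E d))} (hT' : T' ⊆ T) (hne : T'.Nonempty)
    (hadj : ∀ B ∈ T', ∀ D ∈ T, Adjacent B D → D ∈ T') : T' = T := by
  refine hT'.antisymm fun D hD => ?_
  obtain ⟨C, hC⟩ := hne
  obtain ⟨a, ha⟩ := (hT.polytope C (hT' hC)).2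
  obtain ⟨y, hgen, hy⟩ := (hT.dense_setOf_isGenericFrom a).exists_mem_open isOpen_interior
    (hT.polytope D hD).2
  have has := hT.notMem_codimSkeleton (hT' hC) ha two_ne_zero
  have hsub : segment ℝ a y ⊆ interior (⋃₀ T') := by
    refine (convex_segment a y).isPreconnected.subset_of_closure_inter_subset isOpen_interior
      ⟨a, left_mem_segment ℝ a y, interior_mono (Set.subset_sUnion_of_mem hC) ha⟩ ?_
    rintro x ⟨hx, hxs⟩
    exact hT.mem_interior_sUnion_of_forall_adjacent hT' hadj
      (closure_minimal interior_subset (hT.isClosed_sUnion hT') hx)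
      (hgen.notMem_codimSkeleton_of_mem_segment has hxs)
  obtain ⟨B, hB, hyB⟩ := interior_subset (hsub (right_mem_segment ℝ a y))
  rwa [hT.eq_of_mem_interior hD (hT' hB) hy hyB]

end GeneralPosition

/-! ### Segments crossing a facet -/

section HitParam

variable {V : Type*} [NormedAddCommGroup V] [InnerProductSpace ℝ V] {a p n x y : V} {t : ℝ}

/-- The parameter `t` for which `a + t • (y - a)` lies on the hyperplane through `p` with the
normal `n`; it is `0` if the line through `a` and `y` is parallel to this hyperplane. -/
noncomputable def hitParam (a p n y : V) : ℝ :=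
  ⟪n, p - a⟫_ℝ / ⟪n, y - a⟫_ℝ

theorem inner_add_hitParam_smul_sub (hy : ⟪n, y - a⟫_ℝ ≠ 0) :
    ⟪n, a + hitParam a p n y • (y - a) - p⟫_ℝ = 0 := by
  rw [add_sub_right_comm, inner_add_right, real_inner_smul_right, hitParam, div_mul_cancel₀ _ hy,
    ← inner_add_right, sub_add_sub_cancel, sub_self, inner_zero_right]

theorem inner_sub_eq_mul_of_inner_eq_zero (ht : ⟪n, a + t • (y - a) - p⟫_ℝ = 0) :
    ⟪n, p - a⟫_ℝ = t * ⟪n, y - a⟫_ℝ := by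
  rw [← real_inner_smul_right, eq_comm, ← sub_eq_zero, ← inner_sub_right, ← ht]
  congr 1
  abel

theorem inner_sub_ne_zero_of_inner_eq_zero (hp : ⟪n, p - a⟫_ℝ ≠ 0)
    (ht : ⟪n, a + t • (y - a) - p⟫_ℝ = 0) : ⟪n, y - a⟫_ℝ ≠ 0 := by
  rw [inner_sub_eq_mul_of_inner_eq_zero ht] at hp
  exact right_ne_zero_of_mul hp

theorem eq_hitParam (hp : ⟪n, p - a⟫_ℝ ≠ 0) (ht : ⟪n, a + t • (y - a) - p⟫_ℝ = 0) :
    t = hitParam a p n y := by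
  rw [hitParam, eq_div_iff (inner_sub_ne_zero_of_inner_eq_zero hp ht),
    inner_sub_eq_mul_of_inner_eq_zero ht]

theorem tendsto_hitParam (hp : ⟪n, p - a⟫_ℝ ≠ 0) (hpx : p = a + t • (x - a)) :
    Tendsto (hitParam a p n) (𝓝 x) (𝓝 t) := by
  have ht : ⟪n, a + t • (x - a) - p⟫_ℝ = 0 := by rw [← hpx, sub_self, inner_zero_right]
  rw [eq_hitParam hp ht]
  exact ContinuousAt.div continuousAt_const (by fun_prop)
    (inner_sub_ne_zero_of_inner_eq_zero hp ht)

theorem tendsto_add_hitParam_smul (hp : ⟪n, p - a⟫_ℝ ≠ 0) (hpx : p = a + t • (x - a)) :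
    Tendsto (fun y => a + hitParam a p n y • (y - a)) (𝓝 x) (𝓝 p) := by
  conv => rhs; rw [hpx]
  exact tendsto_const_nhds.add
    ((tendsto_hitParam hp hpx).smul (tendsto_id.sub tendsto_const_nhds))

theorem eventually_inner_sub_ne_zero (hp : ⟪n, p - a⟫_ℝ ≠ 0) (hpx : p = a + t • (x - a)) :
    ∀ᶠ y in 𝓝 x, ⟪n, y - a⟫_ℝ ≠ 0 :=
  ContinuousAt.eventually_ne (by fun_prop) <| inner_sub_ne_zero_of_inner_eq_zero hp
    (t := t) (by rw [← hpx, sub_self, inner_zero_right])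

end HitParam

section Crossing

variable {d : ℕ} {T 𝓕 : Set (Set (E d))} {F : Set (E d)} {a n p q x : E d}

theorem IsHyperplaneNormal.inner_sub_ne_zero (hn : IsHyperplaneNormal F n)
    (ha : a ∉ affineSpan ℝ F) (hp : p ∈ F) : ⟪n, p - a⟫_ℝ ≠ 0 := by
  intro h
  rw [← neg_eq_zero, ← inner_neg_right, neg_sub, ← hn.mem_vectorSpan_iff,
    ← direction_affineSpan] at h
  exact ha (by simpa using AffineSubspace.vadd_mem_of_mem_direction h (subset_affineSpan ℝ F hp))

theorem IsHyperplaneNormal.eq_of_mem_segment (hn : IsHyperplaneNormal F n)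
    (ha : a ∉ affineSpan ℝ F) (hp : p ∈ F) (hpx : p ∈ segment ℝ a x) (hq : q ∈ F)
    (hqx : q ∈ segment ℝ a x) : p = q := by
  rw [segment_eq_image'] at hpx hqx
  obtain ⟨t, -, rfl⟩ := hpx
  obtain ⟨u, -, rfl⟩ := hqx
  have hpa := hn.inner_sub_ne_zero ha hp
  dsimp only
  rw [eq_hitParam hpa (hn.inner_sub_eq_zero hq hp), ← eq_hitParam hpa (t := t) (by simp)]

theorem IsHyperplaneNormal.eventually_inter_segment_nonempty_iff (hn : IsHyperplaneNormal F n)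
    (ha : a ∉ affineSpan ℝ F) (hp : p ∈ F) (hpx : p ∈ openSegment ℝ a x) :
    ∀ᶠ y in 𝓝 x, (F ∩ segment ℝ a y).Nonempty ↔ a + hitParam a p n y • (y - a) ∈ F := by
  rw [openSegment_eq_image'] at hpx
  obtain ⟨t, ht, hpx⟩ := hpx
  have hpa := hn.inner_sub_ne_zero ha hp
  filter_upwards [(tendsto_hitParam hpa hpx.symm).eventually (Icc_mem_nhds ht.1 ht.2)] with y hy
  rw [segment_eq_image']
  constructor
  · rintro ⟨_, hF, u, -, rfl⟩
    rwa [← eq_hitParam hpa (hn.inner_sub_eq_zero hF hp)]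
  · exact fun hF => ⟨_, hF, _, hy, rfl⟩

theorem IsHyperplaneNormal.eventually_add_hitParam_smul_mem (hn : IsHyperplaneNormal F n)
    (ha : a ∉ affineSpan ℝ F) (hp : p ∈ intrinsicInterior ℝ F) {t : ℝ}
    (hpx : p = a + t • (x - a)) : ∀ᶠ y in 𝓝 x, a + hitParam a p n y • (y - a) ∈ F := by
  have hpF := intrinsicInterior_subset hp
  have hpa := hn.inner_sub_ne_zero ha hpF
  rw [mem_intrinsicInterior_iff_eventually hpF] at hp
  have hlim := (tendsto_add_hitParam_smul hpa hpx).sub_const p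
  rw [sub_self] at hlim
  filter_upwards [hlim.eventually hp, eventually_inner_sub_ne_zero hpa hpx] with y hy hya
  simpa using hy ((hn.mem_vectorSpan_iff _).2 (inner_add_hitParam_smul_sub hya))

theorem IsLocallyFiniteTiling.exists_isGenericFrom_mem (hT : IsLocallyFiniteTiling T)
    (hn : IsHyperplaneNormal F n) (ha : a ∉ affineSpan ℝ F) (hF : Convex ℝ F)
    (hne : F.Nonempty) : ∃ z ∈ F, IsGenericFrom T a z := by
  obtain ⟨p, hp⟩ := Set.Nonempty.intrinsicInterior hF hne
  have hpa := hn.inner_sub_ne_zero ha (intrinsicInterior_subset hp)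
  have hpx : p = a + (1 : ℝ) • (p - a) := by rw [one_smul, add_sub_cancel]
  have hev := (hn.eventually_add_hitParam_smul_mem ha hp hpx).and
    ((tendsto_hitParam hpa hpx).eventually_ne one_ne_zero)
  obtain ⟨y, hgen, hyF, hy⟩ := (hT.dense_setOf_isGenericFrom a).inter_nhds_nonempty hev
  exact ⟨_, hyF, IsGenericFrom.add_smul_sub hgen hy⟩

/-- The members of the family `𝓕` that meet the segment from `a` to `x`. -/
def crossed (𝓕 : Set (Set (E d))) (a x : E d) : Set (Set (E d)) :=
  {F ∈ 𝓕 | (F ∩ segment ℝ a x).Nonempty}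

theorem eventually_not_inter_segment_nonempty (hF : IsClosed F)
    (h : ¬(F ∩ segment ℝ a x).Nonempty) : ∀ᶠ y in 𝓝 x, ¬(F ∩ segment ℝ a y).Nonempty := by
  have hmiss : ∀ᶠ y in 𝓝 x, ∀ t ∈ Set.Icc (0 : ℝ) 1, a + t • (y - a) ∉ F := by
    refine isCompact_Icc.eventually_forall_of_forall_eventually fun t ht => ?_
    have hcont : Continuous fun z : E d × ℝ => a + z.2 • (z.1 - a) := by fun_prop
    refine hcont.continuousAt.eventually_mem (hF.isOpen_compl.mem_nhds fun hmem => h ⟨_, hmem, ?_⟩)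
    rw [segment_eq_image']
    exact ⟨t, ht, rfl⟩
  filter_upwards [hmiss] with y hy
  rw [segment_eq_image']
  rintro ⟨_, hF, t, ht, rfl⟩
  exact hy t ht hF

theorem IsLocallyFiniteTiling.finite_crossed (hT : IsLocallyFiniteTiling T) (a x : E d) :
    (crossed (facets T) a x).Finite := by
  refine hT.finite_facets_inter_nonempty ?_
  rw [segment_eq_image']
  exact isCompact_Icc.image (by fun_prop)

theorem IsLocallyFiniteTiling.eventually_crossed_subset (hT : IsLocallyFiniteTiling T)
    (a x : E d) : ∀ᶠ y in 𝓝 x, crossed (facets T) a y ⊆ crossed (facets T) a x := by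
  have hfin : {F ∈ facets T | (F ∩ Metric.closedBall x (dist a x + 1)).Nonempty}.Finite :=
    hT.finite_facets_inter_nonempty (isCompact_closedBall x _)
  have hmiss := (hfin.subset (t := {F ∈ facets T |
      (F ∩ Metric.closedBall x (dist a x + 1)).Nonempty ∧ ¬(F ∩ segment ℝ a x).Nonempty})
    fun F hF => ⟨hF.1, hF.2.1⟩).eventually_all.2 fun F hF =>
      eventually_not_inter_segment_nonempty (hT.isClosed_of_mem_facets hF.1) hF.2.2
  filter_upwards [hmiss, Metric.closedBall_mem_nhds x (by positivity : 0 < dist a x + 1)]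
    with y hy hyx F hF
  by_contra hFx
  have hsub : segment ℝ a y ⊆ Metric.closedBall x (dist a x + 1) :=
    (convex_closedBall x _).segment_subset (by simp) hyx
  exact hy F ⟨hF.1, hF.2.mono (Set.inter_subset_inter_right F hsub), fun h => hFx ⟨hF.1, h⟩⟩ hF.2

end Crossing

/-! ### Facets around a ridge -/

section AreaForm

variable {V : Type*} [NormedAddCommGroup V] [InnerProductSpace ℝ V]

/-- The functional `u ↦ ⟪e₁, u⟫ * ⟪e₂, v⟫ - ⟪e₂, u⟫ * ⟪e₁, v⟫`: the signed area spanned by the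
projections of `u` and `v` to the plane with the orthonormal basis `e₁, e₂`. -/
noncomputable def areaForm (e₁ e₂ v : V) : StrongDual ℝ V :=
  ⟪e₂, v⟫_ℝ • innerSL ℝ e₁ - ⟪e₁, v⟫_ℝ • innerSL ℝ e₂

theorem areaForm_apply (e₁ e₂ u v : V) :
    areaForm e₁ e₂ v u = ⟪e₁, u⟫_ℝ * ⟪e₂, v⟫_ℝ - ⟪e₂, u⟫_ℝ * ⟪e₁, v⟫_ℝ := by
  simp [areaForm, mul_comm]

theorem areaForm_self (e₁ e₂ v : V) : areaForm e₁ e₂ v v = 0 := by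
  rw [areaForm_apply]
  ring

theorem areaForm_smul (e₁ e₂ v : V) (c : ℝ) : areaForm e₁ e₂ (c • v) = c • areaForm e₁ e₂ v := by
  simp only [areaForm, real_inner_smul_right, smul_sub, smul_smul]

theorem areaForm_neg (e₁ e₂ v : V) : areaForm e₁ e₂ (-v) = -areaForm e₁ e₂ v := by
  ext u
  simp only [areaForm_apply, neg_apply, inner_neg_right]
  ring

end AreaForm

section Frame

variable {d : ℕ} {F K : Set (E d)} {a e₁ e₂ n p u v x : E d}

theorem exists_isFrameAround (hK : dim K + 2 = d) : ∃ e₁ e₂ : E d, IsFrameAround K e₁ e₂ := by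
  have hfinrank : Module.finrank ℝ (vectorSpan ℝ K)ᗮ = 2 := by
    have := (vectorSpan ℝ K).finrank_add_finrank_orthogonal
    rw [finrank_euclideanSpace_fin, ← dim] at this
    omega
  let b := (stdOrthonormalBasis ℝ (vectorSpan ℝ K)ᗮ).reindex (finCongr hfinrank)
  have hpair : {(b 0 : E d), (b 1 : E d)} = (vectorSpan ℝ K)ᗮ.subtype '' Set.range b := by
    ext x
    simp [Fin.exists_fin_two, eq_comm]
  refine ⟨b 0, b 1, ?_, ?_⟩
  · convert b.orthonormal.comp_linearIsometry (vectorSpan ℝ K)ᗮ.subtypeₗᵢ using 1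
    ext i : 1
    fin_cases i <;> rfl
  · rw [hpair, Submodule.span_image, ← OrthonormalBasis.coe_toBasis, b.toBasis.span_eq,
      Submodule.map_top, Submodule.range_subtype]

namespace IsFrameAround

theorem mem_vectorSpan_iff (he : IsFrameAround K e₁ e₂) :
    v ∈ vectorSpan ℝ K ↔ ⟪e₁, v⟫_ℝ = 0 ∧ ⟪e₂, v⟫_ℝ = 0 := by
  rw [← Submodule.orthogonal_orthogonal (vectorSpan ℝ K), ← he.2, Submodule.mem_orthogonal]
  refine ⟨fun h => ⟨h _ (Submodule.subset_span (by simp)), h _ (Submodule.subset_span (by simp))⟩,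
    fun h w hw => ?_⟩
  obtain ⟨c₁, c₂, rfl⟩ := Submodule.mem_span_pair.1 hw
  rw [inner_add_left, real_inner_smul_left, real_inner_smul_left, h.1, h.2, mul_zero, mul_zero,
    add_zero]

theorem inner_eq (he : IsFrameAround K e₁ e₂) (hu : u ∈ (vectorSpan ℝ K)ᗮ) (v : E d) :
    ⟪u, v⟫_ℝ = ⟪e₁, u⟫_ℝ * ⟪e₁, v⟫_ℝ + ⟪e₂, u⟫_ℝ * ⟪e₂, v⟫_ℝ := by
  have hnorm₁ : ⟪e₁, e₁⟫_ℝ = 1 := by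
    simpa using inner_self_eq_one_of_norm_eq_one (𝕜 := ℝ) (he.1.1 0)
  have hnorm₂ : ⟪e₂, e₂⟫_ℝ = 1 := by
    simpa using inner_self_eq_one_of_norm_eq_one (𝕜 := ℝ) (he.1.1 1)
  have horth : ⟪e₁, e₂⟫_ℝ = 0 := he.1.2 (by decide : (0 : Fin 2) ≠ 1)
  rw [← he.2, Submodule.mem_span_pair] at hu
  obtain ⟨c₁, c₂, rfl⟩ := hu
  simp only [inner_add_left, inner_add_right, real_inner_smul_left, real_inner_smul_right, hnorm₁,
    hnorm₂, horth, real_inner_comm e₁ e₂]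
  ring

theorem areaForm_eq_zero_of_mem_vectorSpan (he : IsFrameAround K e₁ e₂)
    (hu : u ∈ vectorSpan ℝ K) (v : E d) : areaForm e₁ e₂ v u = 0 := by
  obtain ⟨h₁, h₂⟩ := he.mem_vectorSpan_iff.1 hu
  rw [areaForm_apply, h₁, h₂, zero_mul, zero_mul, sub_zero]

theorem exists_sub_smul_mem_vectorSpan (he : IsFrameAround K e₁ e₂) (hu : u ∉ vectorSpan ℝ K)
    (h : areaForm e₁ e₂ u v = 0) : ∃ c : ℝ, v - c • u ∈ vectorSpan ℝ K := by
  have hpos : ⟪e₁, u⟫_ℝ ^ 2 + ⟪e₂, u⟫_ℝ ^ 2 ≠ 0 := fun hsq => hu <| he.mem_vectorSpan_iff.2 <| by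
    constructor <;> nlinarith [sq_nonneg ⟪e₁, u⟫_ℝ, sq_nonneg ⟪e₂, u⟫_ℝ]
  rw [areaForm_apply] at h
  refine ⟨(⟪e₁, u⟫_ℝ * ⟪e₁, v⟫_ℝ + ⟪e₂, u⟫_ℝ * ⟪e₂, v⟫_ℝ) / (⟪e₁, u⟫_ℝ ^ 2 + ⟪e₂, u⟫_ℝ ^ 2),
    he.mem_vectorSpan_iff.2 ?_⟩
  simp only [inner_sub_right, real_inner_smul_right]
  constructor
  · field_simp
    linear_combination ⟪e₂, u⟫_ℝ * h
  · field_simp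
    linear_combination -⟪e₁, u⟫_ℝ * h

end IsFrameAround

theorem IsHyperplaneNormal.mem_orthogonal_vectorSpan (hn : IsHyperplaneNormal F n) (hKF : K ⊆ F) :
    n ∈ (vectorSpan ℝ K)ᗮ :=
  (Submodule.mem_orthogonal' _ _).2 fun v hv =>
    (hn.mem_vectorSpan_iff v).1 (vectorSpan_mono ℝ hKF hv)

theorem IsHyperplaneNormal.areaForm_eq (hn : IsHyperplaneNormal F n) (he : IsFrameAround K e₁ e₂)
    (hKF : K ⊆ F) (u v : E d) :
    areaForm e₁ e₂ v u = ⟪n, v⟫_ℝ * areaForm e₁ e₂ n u - ⟪n, u⟫_ℝ * areaForm e₁ e₂ n v := by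
  have hinner := he.inner_eq (hn.mem_orthogonal_vectorSpan hKF)
  have hunit := hinner n
  rw [hn.inner_self] at hunit
  simp only [areaForm_apply, hinner]
  linear_combination (⟪e₁, u⟫_ℝ * ⟪e₂, v⟫_ℝ - ⟪e₂, u⟫_ℝ * ⟪e₁, v⟫_ℝ) * hunit

theorem IsHyperplaneNormal.mem_vectorSpan_of_areaForm_eq_zero (hn : IsHyperplaneNormal F n)
    (he : IsFrameAround K e₁ e₂) (hKF : K ⊆ F) (hv : v ∈ vectorSpan ℝ F)
    (h : areaForm e₁ e₂ n v = 0) : v ∈ vectorSpan ℝ K := by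
  have hnK : n ∉ vectorSpan ℝ K := fun hmem => by
    have := (hn.mem_vectorSpan_iff n).1 (vectorSpan_mono ℝ hKF hmem)
    exact one_ne_zero (hn.inner_self.symm.trans this)
  obtain ⟨c, hc⟩ := he.exists_sub_smul_mem_vectorSpan hnK h
  have hc0 := (hn.mem_vectorSpan_iff _).1 (vectorSpan_mono ℝ hKF hc)
  rw [inner_sub_right, (hn.mem_vectorSpan_iff v).1 hv, real_inner_smul_right, hn.inner_self,
    mul_one, zero_sub, neg_eq_zero] at hc0
  rwa [hc0, zero_smul, sub_zero] at hc

/-- `n` is the unit normal to the hyperplane spanned by `F` that points to the counterclockwise side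
of `F` as seen along the face `K` of `F`. -/
structure IsCoherentNormal (K F : Set (E d)) (e₁ e₂ n : E d) : Prop
    extends IsHyperplaneNormal F n where
  areaForm_pos : ∀ g ∈ K, ∀ x ∈ F \ K, 0 < areaForm e₁ e₂ n (x - g)

/-- A functional that is negative on `F \ K` relative to `K` and the area form with a normal are
proportional on the span of `F`, both having the span of `K` as their kernel. -/
theorem IsHyperplaneNormal.exists_isCoherentNormal (hn : IsHyperplaneNormal F n)
    (he : IsFrameAround K e₁ e₂) (hK : IsFace F K) (hne : K ≠ F) :
    ∃ m, IsCoherentNormal K F e₁ e₂ m := by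
  obtain ⟨l, hl0, hlneg⟩ := hK.exists_functional
  obtain ⟨q, hqF, hqK⟩ := hK.exists_mem_notMem hne
  obtain ⟨g₀, hg₀⟩ := hK.1
  have hl_pos : ∀ g ∈ K, ∀ x ∈ F \ K, 0 < l (x - g) * l (q - g₀) := fun g hg x hx =>
    mul_pos_of_neg_of_neg (hlneg g hg x hx.1 hx.2) (hlneg g₀ hg₀ q hqF hqK)
  have hmem : ∀ g ∈ K, ∀ x ∈ F, x - g ∈ vectorSpan ℝ F := fun g hg x hx =>
    vsub_mem_vectorSpan ℝ hx (hK.subset hg)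
  have hprop : ∀ g ∈ K, ∀ x ∈ F \ K,
      areaForm e₁ e₂ n (q - g₀) * l (x - g) = areaForm e₁ e₂ n (x - g) * l (q - g₀) := by
    intro g hg x hx
    rw [← sub_eq_zero]
    simpa using hl0 (areaForm e₁ e₂ n (q - g₀) • (x - g) - areaForm e₁ e₂ n (x - g) • (q - g₀)) <|
      hn.mem_vectorSpan_of_areaForm_eq_zero he hK.subset
        (sub_mem (Submodule.smul_mem _ _ (hmem g hg x hx.1))
          (Submodule.smul_mem _ _ (hmem g₀ hg₀ q hqF)))
        (by simp only [map_sub, map_smul, smul_eq_mul]; ring)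
  have hq0 : areaForm e₁ e₂ n (q - g₀) ≠ 0 := fun h0 => by
    have hqspan := hn.mem_vectorSpan_of_areaForm_eq_zero he hK.subset (hmem g₀ hg₀ q hqF) h0
    exact (hlneg g₀ hg₀ q hqF hqK).ne (hl0 _ hqspan)
  rcases hq0.lt_or_gt with hneg | hpos
  · refine ⟨-n, hn.neg, fun g hg x hx => ?_⟩
    have := hprop g hg x hx
    rw [areaForm_neg, neg_apply, neg_pos]
    nlinarith [hl_pos g hg x hx, hlneg g hg x hx.1 hx.2, hlneg g₀ hg₀ q hqF hqK]
  · refine ⟨n, hn, fun g hg x hx => ?_⟩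
    have := hprop g hg x hx
    nlinarith [hl_pos g hg x hx, hlneg g hg x hx.1 hx.2, hlneg g₀ hg₀ q hqF hqK]

namespace IsCoherentNormal

theorem eventually_add_mem_iff (hn : IsCoherentNormal K F e₁ e₂ n) (he : IsFrameAround K e₁ e₂)
    (hF : Convex ℝ F) (hK : IsFace F K) (hne : K ≠ F) (hp : p ∈ intrinsicInterior ℝ K) :
    ∀ᶠ w in 𝓝 0, w ∈ vectorSpan ℝ F → (p + w ∈ F ↔ 0 ≤ areaForm e₁ e₂ n w) := by
  obtain ⟨q, hqF, hqK⟩ := hK.exists_mem_notMem hne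
  have hpK := intrinsicInterior_subset hp
  have hq := hn.areaForm_pos p hpK q ⟨hqF, hqK⟩
  rw [mem_intrinsicInterior_iff_eventually hpK] at hp
  have hW : ∀ᶠ w in 𝓝 0, w ∈ vectorSpan ℝ K → p + w ∈ F :=
    hp.mono fun w hw hwK => hK.subset (hw hwK)
  filter_upwards [eventually_add_mem_of_nonneg hF hW hqF
    ((areaForm e₁ e₂ n (q - p))⁻¹ • areaForm e₁ e₂ n)] with w hw hwF
  constructor
  · intro hpw
    by_cases hwK : p + w ∈ K
    · have hmem : w ∈ vectorSpan ℝ K := by simpa using vsub_mem_vectorSpan ℝ hwK hpK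
      exact (he.areaForm_eq_zero_of_mem_vectorSpan hmem n).ge
    · simpa using (hn.areaForm_pos p hpK _ ⟨hpw, hwK⟩).le
  · intro hpos
    refine hw (mul_nonneg (inv_nonneg.2 hq.le) hpos) ?_
    refine hn.mem_vectorSpan_of_areaForm_eq_zero he hK.subset (sub_mem hwF
      (Submodule.smul_mem _ _ (vsub_mem_vectorSpan ℝ hqF (hK.subset hpK)))) ?_
    rw [map_sub, map_smul, smul_apply, smul_eq_mul, smul_eq_mul,
      mul_right_comm, inv_mul_cancel₀ hq.ne', one_mul, sub_self]

theorem eventually_inter_segment_nonempty_iff (hn : IsCoherentNormal K F e₁ e₂ n)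
    (he : IsFrameAround K e₁ e₂) (hF : Convex ℝ F) (hK : IsFace F K) (hne : K ≠ F)
    (hp : p ∈ intrinsicInterior ℝ K) (ha : a ∉ affineSpan ℝ F) (hpx : p ∈ openSegment ℝ a x) :
    ∀ᶠ y in 𝓝 x,
      (F ∩ segment ℝ a y).Nonempty ↔ 0 ≤ ⟪n, p - a⟫_ℝ * areaForm e₁ e₂ (x - a) (y - a) := by
  have hpF := hK.subset (intrinsicInterior_subset hp)
  have hpa := hn.inner_sub_ne_zero ha hpF
  have hiff := hn.toIsHyperplaneNormal.eventually_inter_segment_nonempty_iff ha hpF hpx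
  rw [openSegment_eq_image'] at hpx
  obtain ⟨t, ht, htp⟩ := hpx
  have hlim := (tendsto_add_hitParam_smul hpa htp.symm).sub_const p
  rw [sub_self] at hlim
  filter_upwards [hiff, hlim.eventually (hn.eventually_add_mem_iff he hF hK hne hp),
    eventually_inner_sub_ne_zero hpa htp.symm,
    (tendsto_hitParam hpa htp.symm).eventually_const_lt ht.1] with y hy hmem hya hpos
  set w := a + hitParam a p n y • (y - a) - p with hw
  have hnw : ⟪n, w⟫_ℝ = 0 := inner_add_hitParam_smul_sub hya
  rw [hy, ← add_sub_cancel p (a + _), hmem ((hn.mem_vectorSpan_iff _).2 hnw)]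
  have hpt : p - a = t • (x - a) := by rw [← htp, add_sub_cancel_left]
  have harea : ⟪n, p - a⟫_ℝ * areaForm e₁ e₂ n w =
      t * hitParam a p n y * areaForm e₁ e₂ (x - a) (y - a) := by
    have hwy : w = hitParam a p n y • (y - a) - (p - a) := by rw [hw]; abel
    rw [← sub_zero (_ * _), ← zero_mul (areaForm e₁ e₂ n (p - a)), ← hnw,
      ← hn.areaForm_eq he hK.subset, hwy, map_sub, areaForm_self, sub_zero, hpt, areaForm_smul,
      map_smul, smul_apply, smul_eq_mul, smul_eq_mul]
    ring
  rw [← mul_nonneg_iff_of_pos_left (mul_self_pos.2 hpa), mul_assoc, harea, mul_left_comm,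
    mul_nonneg_iff_of_pos_left (mul_pos ht.1 hpos)]

end IsCoherentNormal

theorem IsGenericFrom.areaForm_ne_zero {T : Set (Set (E d))} {y : E d}
    (hy : IsGenericFrom T a y) (hK : K ∈ facesOfCodimGE T 2) (he : IsFrameAround K e₁ e₂)
    (hp : p ∈ K) (ha : p - a ∉ vectorSpan ℝ K) : areaForm e₁ e₂ (p - a) (y - a) ≠ 0 := by
  intro h
  obtain ⟨c, hc⟩ := he.exists_sub_smul_mem_vectorSpan ha h
  refine hy K hK ?_
  have hsub : vectorSpan ℝ K ≤ (affineSpan ℝ (insert a K)).direction := by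
    rw [direction_affineSpan]
    exact vectorSpan_mono ℝ (Set.subset_insert a K)
  have hline := AffineMap.lineMap_mem c (mem_affineSpan ℝ (Set.mem_insert a K))
    (mem_affineSpan ℝ (Set.mem_insert_of_mem a hp))
  convert AffineSubspace.vadd_mem_of_mem_direction (hsub hc) hline using 1
  rw [AffineMap.lineMap_apply, vsub_eq_sub, vadd_eq_add, vadd_eq_add]
  abel

theorem IsNormalTiling.exists_ridge {T : Set (Set (E d))} (hT : IsNormalTiling T)
    (hp : p ∈ codimSkeleton T 2) (hp₃ : p ∉ codimSkeleton T 3) :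
    ∃ K ∈ ridges T, p ∈ intrinsicInterior ℝ K ∧ ∀ F ∈ facets T, p ∈ F → IsFace F K := by
  obtain ⟨K, ⟨C, hC, hK, hdim⟩, hpK⟩ := hp
  have hdim_eq : dim K + 2 = d :=
    hdim.antisymm (by by_contra! hlt; exact hp₃ (hK.mem_codimSkeleton hC (by omega) hpK))
  refine ⟨K, ⟨C, hC, hK, hdim_eq⟩,
    hK.mem_intrinsicInterior hC (hT.polytope C hC) (by omega) hpK hp₃, ?_⟩
  rintro F ⟨D, hD, hF, -⟩ hpF
  have hKD : IsFace D K := by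
    rcases eq_or_ne D C with rfl | hne
    · exact hK
    obtain ⟨hfD, hfC⟩ := hT.isFace_inter hD hC hne ⟨p, hF.subset hpF, hK.subset hpK⟩
    have hsub := hK.subset_of_mem hC hfC (j := 3) (by omega) hpK ⟨hF.subset hpF, hK.subset hpK⟩ hp₃
    exact hfD.trans (hT.polytope D hD) (hK.of_subset hsub Set.inter_subset_right)
  exact hKD.of_subset (hKD.subset_of_mem hD hF (j := 3) (by omega) hpK hpF hp₃) hF.subset

end Frame

/-! ### Sums over crossed facets -/

theorem eq_of_dense_of_isPreconnected {X Y : Type*} [TopologicalSpace X] {f : X → Y} {G S : Set X}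
    {x z : X} (hG : Dense G) (hS : IsPreconnected S)
    (h : ∀ x ∈ S, ∃ c, ∀ᶠ y in 𝓝 x, y ∈ G → f y = c) (hx : x ∈ S) (hxG : x ∈ G) (hz : z ∈ S)
    (hzG : z ∈ G) : f x = f z := by
  have : Nonempty Y := ⟨f x⟩
  choose! c hc using h
  have hconst : c x = c z := by
    refine hS.induction₂ (fun x z => c x = c z) (fun x hx => ?_) (fun _ _ _ _ _ _ => Eq.trans)
      (fun _ _ _ _ => Eq.symm) hx hz
    filter_upwards [self_mem_nhdsWithin, nhdsWithin_le_nhds (hc x hx).eventually_nhds]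
      with x' hx' hev
    obtain ⟨y, hyG, hy, hy'⟩ := hG.inter_nhds_nonempty (hev.and (hc x' hx'))
    exact (hy hyG).symm.trans (hy' hyG)
  rw [(hc x hx).self_of_nhds hxG, (hc z hz).self_of_nhds hzG, hconst]

theorem finsum_mem_sign_smul {ι V : Type*} [AddCommGroup V] [Module ℝ V] {s : Set ι}
    (hs : s.Finite) {c : ι → ℝ} (hc : ∀ i ∈ s, c i ≠ 0) (w : ι → V) :
    ∑ᶠ i ∈ s, (SignType.sign (c i) : ℝ) • w i =
      ∑ᶠ i ∈ {i ∈ s | 0 < c i}, w i - ∑ᶠ i ∈ {i ∈ s | c i < 0}, w i := by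
  have hunion : s = {i ∈ s | 0 < c i} ∪ {i ∈ s | c i < 0} := by
    ext i
    have := hc i
    grind
  have hdisj : Disjoint {i ∈ s | 0 < c i} {i ∈ s | c i < 0} :=
    Set.disjoint_left.2 fun i hi hi' => hi.2.not_gt hi'.2
  rw [hunion, finsum_mem_union hdisj (hs.subset (Set.sep_subset _ _))
    (hs.subset (Set.sep_subset _ _)), ← hunion, sub_eq_add_neg, ← finsum_mem_neg_distrib _
    (hs.subset (Set.sep_subset _ _))]
  congr 1
  · exact finsum_mem_congr rfl fun i hi => by simp [sign_pos hi.2]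
  · exact finsum_mem_congr rfl fun i hi => by simp [sign_neg hi.2]

theorem finsum_mem_setOf_mul_nonneg_eq {ι V : Type*} [AddCommGroup V] [Module ℝ V] {s : Set ι}
    (hs : s.Finite) {c : ι → ℝ} (hc : ∀ i ∈ s, c i ≠ 0) {w : ι → V}
    (hw : ∑ᶠ i ∈ s, (SignType.sign (c i) : ℝ) • w i = 0) {r : ℝ} (hr : r ≠ 0) :
    ∑ᶠ i ∈ {i ∈ s | 0 ≤ c i * r}, w i = ∑ᶠ i ∈ {i ∈ s | 0 < c i}, w i := by
  rcases hr.lt_or_gt with hr | hr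
  · rw [finsum_mem_sign_smul hs hc, sub_eq_zero] at hw
    rw [hw]
    refine finsum_mem_congr (Set.ext fun i => and_congr_right fun hi => ?_) fun _ _ => rfl
    rw [← neg_mul_neg, mul_nonneg_iff_of_pos_right (neg_pos.2 hr), neg_nonneg,
      (hc i hi).le_iff_lt]
  · refine finsum_mem_congr (Set.ext fun i => and_congr_right fun hi => ?_) fun _ _ => rfl
    rw [mul_nonneg_iff_of_pos_right hr, (hc i hi).symm.le_iff_lt]

section CrossSum

variable {d : ℕ} {V : Type*} [AddCommGroup V] {T : Set (Set (E d))} {F K : Set (E d)}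
  {a p q x y : E d} {w : Set (E d) → V}

/-- The sum of the weights of the members of `𝓕` that meet the segment from `a` to `y`. -/
noncomputable def crossSum (w : Set (E d) → V) (𝓕 : Set (Set (E d))) (a y : E d) : V :=
  ∑ᶠ F ∈ crossed 𝓕 a y, w F

/-- The point `a` is in general position with respect to the faces of positive codimension. -/
def IsGenericBase (T : Set (Set (E d))) (a : E d) : Prop :=
  ∀ K ∈ facesOfCodimGE T 1, a ∉ affineSpan ℝ K

theorem IsLocallyFiniteTiling.exists_isGenericBase (hT : IsLocallyFiniteTiling T) :
    ∃ a, IsGenericBase T a := by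
  refine (dense_setOf_forall_notMem_affineSubspace (hT.countable_facesOfCodimGE 1) ?_).nonempty
  rintro K ⟨C, -, -, hdim⟩
  refine affineSpan_ne_top_of_finrank_lt ?_
  rw [finrank_euclideanSpace_fin]
  exact hdim

theorem IsNormalTiling.exists_isHyperplaneNormal (hT : IsNormalTiling T) (hF : F ∈ facets T) :
    ∃ n, IsHyperplaneNormal F n := by
  obtain ⟨C, hC, hF⟩ := hF
  obtain ⟨n, hn⟩ := hF.exists_isOuterNormal (hT.polytope C hC)
  exact ⟨n, hn.toIsHyperplaneNormal⟩

namespace IsGenericBase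

theorem notMem_affineSpan (ha : IsGenericBase T a) (hF : F ∈ facets T) : a ∉ affineSpan ℝ F :=
  ha F (facets_subset_facesOfCodimGE hF)

theorem notMem (ha : IsGenericBase T a) (hF : F ∈ facets T) : a ∉ F :=
  fun h => ha.notMem_affineSpan hF (mem_affineSpan ℝ h)

theorem notMem_codimSkeleton (ha : IsGenericBase T a) {j : ℕ} (hj : 1 ≤ j) :
    a ∉ codimSkeleton T j := by
  rintro ⟨K, ⟨C, hC, hK, hdim⟩, haK⟩
  exact ha K ⟨C, hC, hK, by omega⟩ (mem_affineSpan ℝ haK)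

theorem sub_notMem_vectorSpan (ha : IsGenericBase T a) (hK : K ∈ facesOfCodimGE T 1)
    (hp : p ∈ K) : p - a ∉ vectorSpan ℝ K := by
  intro h
  rw [← neg_mem_iff, neg_sub, ← direction_affineSpan] at h
  exact ha K hK
    (by simpa using AffineSubspace.vadd_mem_of_mem_direction h (mem_affineSpan ℝ hp))

theorem eq_of_mem_segment (ha : IsGenericBase T a) (hT : IsNormalTiling T) (hF : F ∈ facets T)
    (hp : p ∈ F) (hpx : p ∈ segment ℝ a x) (hq : q ∈ F) (hqx : q ∈ segment ℝ a x) : p = q := by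
  obtain ⟨n, hn⟩ := hT.exists_isHyperplaneNormal hF
  exact hn.eq_of_mem_segment (ha.notMem_affineSpan hF) hp hpx hq hqx

end IsGenericBase

theorem IsLocallyFiniteTiling.finite_facets_mem (hT : IsLocallyFiniteTiling T) (p : E d) :
    {F ∈ facets T | p ∈ F}.Finite := by
  simpa using hT.finite_facets_inter_nonempty (isCompact_singleton (x := p))

theorem IsLocallyFiniteTiling.finite_inter_segment (hT : IsLocallyFiniteTiling T)
    (ha : IsGenericBase T a) (x : E d) : (⋃₀ facets T ∩ segment ℝ a x).Finite := by
  refine ((hT.finite_crossed a x).biUnion (t := fun F => F ∩ segment ℝ a x)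
    fun F hF => Set.Subsingleton.finite ?_).subset ?_
  · rintro p ⟨hpF, hpx⟩ q ⟨hqF, hqx⟩
    exact ha.eq_of_mem_segment hT.toIsNormalTiling hF.1 hpF hpx hqF hqx
  · rintro p ⟨⟨F, hF, hpF⟩, hpx⟩
    exact Set.mem_biUnion ⟨hF, p, hpF, hpx⟩ ⟨hpF, hpx⟩

theorem IsLocallyFiniteTiling.eventually_crossSum_eq_finsum (hT : IsLocallyFiniteTiling T)
    (ha : IsGenericBase T a) (w : Set (E d) → V) (x : E d) :
    ∀ᶠ y in 𝓝 x, crossSum w (facets T) a y =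
      ∑ᶠ p ∈ ⋃₀ facets T ∩ segment ℝ a x, crossSum w {F ∈ facets T | p ∈ F} a y := by
  filter_upwards [hT.eventually_crossed_subset a x] with y hy
  have hunion : crossed (facets T) a y =
      ⋃ p ∈ ⋃₀ facets T ∩ segment ℝ a x, crossed {F ∈ facets T | p ∈ F} a y := by
    refine Set.Subset.antisymm (fun F hF => ?_) (Set.iUnion₂_subset fun p _ F hF => ?_)
    · obtain ⟨hFT, p, hpF, hpx⟩ := hy hF
      exact Set.mem_biUnion ⟨⟨F, hFT, hpF⟩, hpx⟩ ⟨⟨hFT, hpF⟩, hF.2⟩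
    · exact ⟨hF.1.1, hF.2⟩
  have hdisj : (⋃₀ facets T ∩ segment ℝ a x).PairwiseDisjoint
      fun p => crossed {F ∈ facets T | p ∈ F} a y := fun p hp q hq hpq =>
    Set.disjoint_left.2 fun F hF hF' => hpq <|
      ha.eq_of_mem_segment hT.toIsNormalTiling hF.1.1 hF.1.2 hp.2 hF'.1.2 hq.2
  have hfin : ∀ p ∈ ⋃₀ facets T ∩ segment ℝ a x, (crossed {F ∈ facets T | p ∈ F} a y).Finite :=
    fun p _ => (hT.finite_facets_mem p).subset (Set.sep_subset _ _)
  rw [crossSum, hunion, finsum_mem_biUnion hdisj (hT.finite_inter_segment ha x) hfin]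
  rfl

variable [Module ℝ V]

/-- The weights cancel around every ridge `K`, when every facet around `K` is given the sign that
tells whether its coherent normal points away from `a`. -/
def IsBalanced (T : Set (Set (E d))) (a : E d) (w : Set (E d) → V) : Prop :=
  ∀ K ∈ ridges T, ∀ e₁ e₂ : E d, IsFrameAround K e₁ e₂ →
    ∀ m : Set (E d) → E d, AreCoherentNormals T K e₁ e₂ m →
      ∀ p ∈ K, ∑ᶠ F ∈ facetsContaining T K, (SignType.sign ⟪m F, p - a⟫_ℝ : ℝ) • w F = 0

theorem areCoherentNormals_of_forall_isCoherentNormal {e₁ e₂ : E d} {m : Set (E d) → E d}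
    (hm : ∀ F ∈ facetsContaining T K, IsCoherentNormal K F e₁ e₂ (m F)) :
    AreCoherentNormals T K e₁ e₂ m := by
  refine fun F hF => ⟨(hm F hF).isUnitNormal, fun g hg x hx => ?_⟩
  rw [← areaForm_apply]
  exact (hm F hF).areaForm_pos g hg x hx

theorem IsLocallyFiniteTiling.eventually_crossed_eq (hT : IsLocallyFiniteTiling T)
    (ha : IsGenericBase T a) (hpx : p ∈ openSegment ℝ a x) (hp : p ∉ codimSkeleton T 2) :
    ∀ᶠ y in 𝓝 x, crossed {F ∈ facets T | p ∈ F} a y = {F ∈ facets T | p ∈ F} := by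
  have hev : ∀ F ∈ {F ∈ facets T | p ∈ F}, ∀ᶠ y in 𝓝 x, (F ∩ segment ℝ a y).Nonempty := by
    rintro F ⟨hF, hpF⟩
    obtain ⟨n, hn⟩ := hT.exists_isHyperplaneNormal hF
    have haF := ha.notMem_affineSpan hF
    have hint := hT.mem_intrinsicInterior_of_mem_facets hF hpF hp
    have hiff := hn.eventually_inter_segment_nonempty_iff haF hpF hpx
    rw [openSegment_eq_image'] at hpx
    obtain ⟨t, -, htp⟩ := hpx
    filter_upwards [hiff, hn.eventually_add_hitParam_smul_mem haF hint htp.symm] with y hy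
    exact hy.2
  filter_upwards [(hT.finite_facets_mem p).eventually_all.2 hev] with y hy
  exact Set.sep_eq_self_iff_mem_true.2 hy

theorem ridge_ne_of_mem_facets (hK : dim K + 2 = d) (hF : F ∈ facets T) : K ≠ F := by
  rintro rfl
  obtain ⟨D, -, hD⟩ := hF
  have := hD.2
  omega

theorem IsNormalTiling.exists_isCoherentNormal (hT : IsNormalTiling T) {e₁ e₂ : E d}
    (he : IsFrameAround K e₁ e₂) (hK : dim K + 2 = d)
    (hface : ∀ F ∈ facetsContaining T K, IsFace F K) :
    ∃ m : Set (E d) → E d, ∀ F ∈ facetsContaining T K, IsCoherentNormal K F e₁ e₂ (m F) := by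
  have hcoh : ∀ F ∈ facetsContaining T K, ∃ n, IsCoherentNormal K F e₁ e₂ n := fun F hF => by
    obtain ⟨n, hn⟩ := hT.exists_isHyperplaneNormal hF.1
    exact hn.exists_isCoherentNormal he (hface F hF) (ridge_ne_of_mem_facets hK hF.1)
  choose! m hm using hcoh
  exact ⟨m, hm⟩

theorem IsGenericFrom.areaForm_ne_zero_of_mem_openSegment (hy : IsGenericFrom T a y)
    (ha : IsGenericBase T a) (hK : K ∈ ridges T) {e₁ e₂ : E d} (he : IsFrameAround K e₁ e₂)
    (hp : p ∈ K) (hpx : p ∈ openSegment ℝ a x) : areaForm e₁ e₂ (x - a) (y - a) ≠ 0 := by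
  obtain ⟨C, hC, hK⟩ := hK
  have hpa := ha.sub_notMem_vectorSpan ⟨C, hC, hK.1, by have := hK.2; omega⟩ hp
  have harea := hy.areaForm_ne_zero ⟨C, hC, hK.1, hK.2.le⟩ he hp hpa
  rw [openSegment_eq_image'] at hpx
  obtain ⟨t, -, rfl⟩ := hpx
  contrapose! harea
  simp [areaForm_smul, harea]

theorem IsBalanced.exists_eventually_crossSum_eq_of_mem_ridge (hw : IsBalanced T a w)
    (hT : IsLocallyFiniteTiling T) (ha : IsGenericBase T a) (hpx : p ∈ openSegment ℝ a x)
    (hp : p ∈ codimSkeleton T 2) (hp₃ : p ∉ codimSkeleton T 3) :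
    ∃ c, ∀ᶠ y in 𝓝 x, IsGenericFrom T a y → crossSum w {F ∈ facets T | p ∈ F} a y = c := by
  obtain ⟨K, hKT, hpi, hface⟩ := hT.exists_ridge hp hp₃
  obtain ⟨_, _, hK⟩ := id hKT
  have hpK := intrinsicInterior_subset hpi
  obtain ⟨e₁, e₂, he⟩ := exists_isFrameAround hK.2
  obtain ⟨m, hm⟩ := hT.exists_isCoherentNormal he hK.2 fun F hF => hface F hF.1 (hF.2 hpK)
  have hzero := hw K hKT e₁ e₂ he m (areCoherentNormals_of_forall_isCoherentNormal hm) p hpK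
  have hcont : facetsContaining T K = {F ∈ facets T | p ∈ F} := by
    ext F
    exact ⟨fun hF => ⟨hF.1, hF.2 hpK⟩, fun hF => ⟨hF.1, (hface F hF.1 hF.2).subset⟩⟩
  rw [hcont] at hm hzero
  have hma : ∀ F ∈ {F ∈ facets T | p ∈ F}, ⟪m F, p - a⟫_ℝ ≠ 0 := fun F hF =>
    (hm F hF).inner_sub_ne_zero (ha.notMem_affineSpan hF.1) hF.2
  have hev : ∀ F ∈ {F ∈ facets T | p ∈ F}, ∀ᶠ y in 𝓝 x, (F ∩ segment ℝ a y).Nonempty ↔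
      0 ≤ ⟪m F, p - a⟫_ℝ * areaForm e₁ e₂ (x - a) (y - a) := by
    rintro F ⟨hF, hpF⟩
    obtain ⟨D, hD, hDF⟩ := id hF
    exact (hm F ⟨hF, hpF⟩).eventually_inter_segment_nonempty_iff he
      (hDF.1.convex (hT.polytope D hD).convex) (hface F hF hpF) (ridge_ne_of_mem_facets hK.2 hF)
      hpi (ha.notMem_affineSpan hF) hpx
  refine ⟨∑ᶠ F ∈ {F ∈ {F ∈ facets T | p ∈ F} | 0 < ⟪m F, p - a⟫_ℝ}, w F, ?_⟩
  filter_upwards [(hT.finite_facets_mem p).eventually_all.2 hev] with y hy hgen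
  have hcrossed : crossed {F ∈ facets T | p ∈ F} a y = {F ∈ {F ∈ facets T | p ∈ F} |
      0 ≤ ⟪m F, p - a⟫_ℝ * areaForm e₁ e₂ (x - a) (y - a)} :=
    Set.ext fun F => and_congr_right (hy F)
  rw [crossSum, hcrossed, finsum_mem_setOf_mul_nonneg_eq (hT.finite_facets_mem p) hma hzero
    (hgen.areaForm_ne_zero_of_mem_openSegment ha hKT he hpK hpx)]
  rfl

theorem IsBalanced.exists_eventually_crossSum_eq_of_mem_openSegment (hw : IsBalanced T a w)
    (hT : IsLocallyFiniteTiling T) (ha : IsGenericBase T a) (hpx : p ∈ openSegment ℝ a x)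
    (hp₃ : p ∉ codimSkeleton T 3) :
    ∃ c, ∀ᶠ y in 𝓝 x, IsGenericFrom T a y → crossSum w {F ∈ facets T | p ∈ F} a y = c := by
  by_cases hp : p ∈ codimSkeleton T 2
  · exact hw.exists_eventually_crossSum_eq_of_mem_ridge hT ha hpx hp hp₃
  · refine ⟨∑ᶠ F ∈ {F ∈ facets T | p ∈ F}, w F, ?_⟩
    filter_upwards [hT.eventually_crossed_eq ha hpx hp] with y hy _
    rw [crossSum, hy]
    rfl

theorem IsBalanced.exists_eventually_crossSum_facets_eq (hw : IsBalanced T a w)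
    (hT : IsLocallyFiniteTiling T) (ha : IsGenericBase T a) (hx : x ∉ ⋃₀ facets T)
    (hseg : ∀ p ∈ segment ℝ a x, p ∉ codimSkeleton T 3) :
    ∃ c, ∀ᶠ y in 𝓝 x, IsGenericFrom T a y → crossSum w (facets T) a y = c := by
  have hloc : ∀ p ∈ ⋃₀ facets T ∩ segment ℝ a x, ∃ c, ∀ᶠ y in 𝓝 x, IsGenericFrom T a y →
      crossSum w {F ∈ facets T | p ∈ F} a y = c := by
    rintro p ⟨hpT, hpx⟩
    refine hw.exists_eventually_crossSum_eq_of_mem_openSegment hT ha ?_ (hseg p hpx)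
    refine mem_openSegment_of_ne_left_right ?_ ?_ hpx
    · rintro rfl
      obtain ⟨F, hF, haF⟩ := hpT
      exact ha.notMem hF haF
    · rintro rfl
      exact hx hpT
  choose! c hc using hloc
  refine ⟨∑ᶠ p ∈ ⋃₀ facets T ∩ segment ℝ a x, c p, ?_⟩
  filter_upwards [hT.eventually_crossSum_eq_finsum ha w x,
    (hT.finite_inter_segment ha x).eventually_all.2 hc] with y hy hcy hgen
  rw [hy]
  exact finsum_mem_congr rfl fun p hp => hcy p hp hgen

end CrossSum

section Potential

variable {d : ℕ} {V : Type*} [AddCommGroup V] {T : Set (Set (E d))} {C D F G K : Set (E d)}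
  {a n p q x y z : E d} {w : Set (E d) → V}

theorem IsLocallyFiniteTiling.dense_setOf_notMem_affineSpan_insert_insert
    (hT : IsLocallyFiniteTiling T) (a : E d) {B : Set (E d)} (hB : B.Countable) :
    Dense {z | ∀ x ∈ B, ∀ K ∈ facesOfCodimGE T 3, z ∉ affineSpan ℝ (insert a (insert x K))} := by
  have hproper : ∀ i ∈ B ×ˢ facesOfCodimGE T 3,
      affineSpan ℝ (insert a (insert i.1 i.2)) ≠ ⊤ := by
    rintro ⟨x, K⟩ ⟨-, C, -, -, hdim⟩
    refine affineSpan_ne_top_of_finrank_lt ?_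
    have hxK := finrank_vectorSpan_insert_le_set ℝ K x
    have haxK := finrank_vectorSpan_insert_le_set ℝ (insert x K) a
    dsimp only [dim] at hdim ⊢
    rw [finrank_euclideanSpace_fin]
    omega
  refine Dense.mono (fun z hz x hx K hK => ?_)
    (dense_setOf_forall_notMem_affineSubspace (hB.prod (hT.countable_facesOfCodimGE 3)) hproper)
  exact hz (x, K) ⟨hx, hK⟩

theorem IsGenericFrom.notMem_codimSkeleton_three (hx : IsGenericFrom T a x)
    (ha : IsGenericBase T a)
    (hz : ∀ K ∈ facesOfCodimGE T 3, z ∉ affineSpan ℝ (insert a (insert x K)))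
    (hp : p ∈ segment ℝ x z) (hq : q ∈ segment ℝ a p) : q ∉ codimSkeleton T 3 := by
  rw [segment_eq_image'] at hp hq
  obtain ⟨u, -, rfl⟩ := hp
  obtain ⟨t, ht, rfl⟩ := hq
  rcases eq_or_ne t 0 with rfl | ht₀
  · simpa using ha.notMem_codimSkeleton (j := 3) (by omega)
  rcases eq_or_ne u 0 with rfl | hu₀
  · refine fun h => hx.notMem_codimSkeleton_of_mem_segment (ha.notMem_codimSkeleton one_le_two) ?_
      (codimSkeleton_anti (by omega : 2 ≤ 3) h)
    rw [segment_eq_image']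
    exact ⟨t, ht, by simp⟩
  · rintro ⟨K, hK, hqK⟩
    have haA : a ∈ affineSpan ℝ (insert a (insert x K)) := mem_affineSpan ℝ (by simp)
    have hxA : x ∈ affineSpan ℝ (insert a (insert x K)) := mem_affineSpan ℝ (by simp)
    have hqA : a + t • (x + u • (z - x) - a) ∈ affineSpan ℝ (insert a (insert x K)) :=
      mem_affineSpan ℝ (Set.mem_insert_of_mem _ (Set.mem_insert_of_mem _ hqK))
    exact hz K hK (mem_of_add_smul_sub_mem hxA hu₀ (mem_of_add_smul_sub_mem haA ht₀ hqA))

theorem IsNormalTiling.notMem_sUnion_facets (hT : IsNormalTiling T) (hC : C ∈ T)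
    (hx : x ∈ interior C) : x ∉ ⋃₀ facets T := by
  rintro ⟨F, hF, hxF⟩
  exact hT.notMem_codimSkeleton hC hx one_ne_zero ⟨F, facets_subset_facesOfCodimGE hF, hxF⟩

theorem IsBalanced.crossSum_eq_of_mem_interior [Module ℝ V] (hw : IsBalanced T a w)
    (hT : IsLocallyFiniteTiling T) (ha : IsGenericBase T a) (hC : C ∈ T) (hx : x ∈ interior C)
    (hxg : IsGenericFrom T a x) (hy : y ∈ interior C) (hyg : IsGenericFrom T a y) :
    crossSum w (facets T) a x = crossSum w (facets T) a y := by
  obtain ⟨z, hz, hzC⟩ := (hT.dense_setOf_notMem_affineSpan_insert_insert a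
    (Set.toFinite {x, y}).countable).exists_mem_open isOpen_interior (hT.polytope C hC).2
  have hconv := (hT.polytope C hC).convex.interior
  have hpath : IsPreconnected (segment ℝ x z ∪ segment ℝ y z) :=
    (convex_segment x z).isPreconnected.union z (right_mem_segment ℝ x z)
      (right_mem_segment ℝ y z) (convex_segment y z).isPreconnected
  refine eq_of_dense_of_isPreconnected (hT.dense_setOf_isGenericFrom a) hpath ?_
    (Or.inl (left_mem_segment ℝ x z)) hxg (Or.inr (left_mem_segment ℝ y z)) hyg
  rintro p (hp | hp)
  · exact hw.exists_eventually_crossSum_facets_eq hT ha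
      (hT.notMem_sUnion_facets hC (hconv.segment_subset hx hzC hp))
      fun q => hxg.notMem_codimSkeleton_three ha (hz x (by simp)) hp
  · exact hw.exists_eventually_crossSum_facets_eq hT ha
      (hT.notMem_sUnion_facets hC (hconv.segment_subset hy hzC hp))
      fun q => hyg.notMem_codimSkeleton_three ha (hz y (by simp)) hp

theorem IsNormalTiling.eq_inter_of_mem_facets (hT : IsNormalTiling T) (hC : C ∈ T)
    (hadj : Adjacent C D) (hx : x ∈ C ∩ D) (hxs : x ∉ codimSkeleton T 2) (hG : G ∈ facets T)
    (hxG : x ∈ G) : G = C ∩ D := by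
  obtain ⟨B, hB, hGB⟩ := hG
  by_cases hBC : B = C
  · subst hBC
    exact hGB.eq_of_mem hB hadj.1 hxG hx hxs
  have hxB := hGB.1.subset hxG
  obtain ⟨hfaceB, hfaceC⟩ := hT.isFace_inter hB hC hBC ⟨x, hxB, hx.1⟩
  have hsub : G ⊆ B ∩ C :=
    hGB.1.subset_of_mem hB hfaceB (by have := hGB.2; omega) hxG ⟨hxB, hx.1⟩ hxs
  have hlt := hfaceC.dim_lt_of_ne (hT.polytope C hC)
    (by rw [Set.inter_comm]; exact hT.inter_ne hC hB (Ne.symm hBC))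
  have hle : dim G ≤ dim (B ∩ C) := Submodule.finrank_mono (vectorSpan_mono ℝ hsub)
  have hdim : dim (B ∩ C) + 1 = d := by have := hGB.2; omega
  exact (hGB.eq_of_mem hB ⟨hfaceB, hdim⟩ hxG ⟨hxB, hx.1⟩ hxs).trans
    (IsFacet.eq_of_mem hC ⟨hfaceC, hdim⟩ hadj.1 ⟨hxB, hx.1⟩ hx hxs)

theorem tendsto_add_smul_sub (a z : E d) :
    Tendsto (fun t : ℝ => a + t • (z - a)) (𝓝 1) (𝓝 z) :=
  Continuous.tendsto' (by fun_prop) _ _ (by simp)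

theorem inner_add_smul_sub_sub (n a z : E d) (t : ℝ) :
    ⟪n, a + t • (z - a) - z⟫_ℝ = (t - 1) * ⟪n, z - a⟫_ℝ := by
  rw [← real_inner_smul_right]
  congr 1
  module

theorem add_smul_mem_segment_add_smul {v : E d} {r t : ℝ} (hr : 0 ≤ r) (hrt : r ≤ t) :
    a + r • v ∈ segment ℝ a (a + t • v) := by
  rw [segment_eq_image']
  refine ⟨r / t, ⟨div_nonneg hr (hr.trans hrt), div_le_one_of_le₀ hrt (hr.trans hrt)⟩, ?_⟩
  rcases eq_or_ne t 0 with rfl | ht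
  · simp [le_antisymm hrt hr]
  · simp [smul_smul, ht]

theorem IsLocallyFiniteTiling.eventually_crossed_add_smul_eq_of_gt (hT : IsLocallyFiniteTiling T)
    (a z : E d) :
    ∀ᶠ t in 𝓝[>] (1 : ℝ), crossed (facets T) a (a + t • (z - a)) = crossed (facets T) a z := by
  filter_upwards [self_mem_nhdsWithin, nhdsWithin_le_nhds
    ((tendsto_add_smul_sub a z).eventually (hT.eventually_crossed_subset a z))] with t ht hsub
  refine hsub.antisymm fun F hF => ⟨hF.1, hF.2.mono (Set.inter_subset_inter_right F ?_)⟩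
  refine (convex_segment _ _).segment_subset (left_mem_segment ℝ _ _) ?_
  simpa using add_smul_mem_segment_add_smul (a := a) (v := z - a) zero_le_one ht.le

theorem IsLocallyFiniteTiling.eventually_crossed_add_smul_eq_of_lt (hT : IsLocallyFiniteTiling T)
    (ha : IsGenericBase T a) (z : E d) :
    ∀ᶠ t in 𝓝[<] (1 : ℝ), crossed (facets T) a (a + t • (z - a)) =
      {F ∈ crossed (facets T) a z | z ∉ F} := by
  have hcross : ∀ F ∈ {F ∈ crossed (facets T) a z | z ∉ F}, ∀ᶠ t in 𝓝[<] (1 : ℝ),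
      (F ∩ segment ℝ a (a + t • (z - a))).Nonempty := by
    rintro F ⟨⟨-, q, hqF, hqz⟩, hzF⟩
    rw [segment_eq_image'] at hqz
    obtain ⟨r, hr, rfl⟩ := hqz
    have hr₁ : r < 1 := hr.2.lt_of_ne fun h => hzF (by simpa [h] using hqF)
    filter_upwards [nhdsWithin_le_nhds (eventually_gt_nhds hr₁)] with t ht
    exact ⟨_, hqF, add_smul_mem_segment_add_smul hr.1 ht.le⟩
  filter_upwards [self_mem_nhdsWithin, nhdsWithin_le_nhds (lt_mem_nhds one_pos),
    nhdsWithin_le_nhds ((tendsto_add_smul_sub a z).eventually (hT.eventually_crossed_subset a z)),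
    (((hT.finite_crossed a z).subset (Set.sep_subset _ _)).eventually_all).2 hcross]
    with t ht ht₀ hsub hsup
  refine Set.Subset.antisymm (fun F hF => ⟨hsub hF, fun hzF => ?_⟩)
    fun F hF => ⟨hF.1.1, hsup F hF⟩
  obtain ⟨q, hqF, hqt⟩ := hF.2
  rw [segment_eq_image'] at hqt
  obtain ⟨r, hr, rfl⟩ := hqt
  simp only [add_sub_cancel_left, smul_smul] at hqF
  obtain ⟨n, hn⟩ := hT.exists_isHyperplaneNormal hF.1
  have hmul := hn.inner_sub_eq_zero hqF hzF
  rw [inner_add_smul_sub_sub] at hmul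
  exact mul_ne_zero (sub_neg.2 (mul_lt_one_of_nonneg_of_lt_one_right hr.2 ht₀.le ht)).ne
    (hn.inner_sub_ne_zero (ha.notMem_affineSpan hF.1) hzF) hmul

theorem IsLocallyFiniteTiling.crossed_eq_insert (hT : IsLocallyFiniteTiling T) (hC : C ∈ T)
    (hadj : Adjacent C D) (hz : z ∈ C ∩ D) (hzg : IsGenericFrom T a z) :
    crossed (facets T) a z = insert (C ∩ D) {F ∈ crossed (facets T) a z | z ∉ F} := by
  refine Set.Subset.antisymm (fun F hF => ?_) (Set.insert_subset ?_ (Set.sep_subset _ _))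
  · by_cases hzF : z ∈ F
    · exact Or.inl (hT.eq_inter_of_mem_facets hC hadj hz hzg.notMem_codimSkeleton hF.1 hzF)
    · exact Or.inr ⟨hF, hzF⟩
  · exact ⟨⟨C, hC, hadj.1⟩, z, hz, right_mem_segment ℝ a z⟩

theorem IsLocallyFiniteTiling.exists_crossSum_eq_add (hT : IsLocallyFiniteTiling T)
    (ha : IsGenericBase T a) (w : Set (E d) → V) (hC : C ∈ T) (hD : D ∈ T) (hadj : Adjacent C D)
    (hn : IsOuterNormal C (C ∩ D) n) (hz : z ∈ C ∩ D) (hzg : IsGenericFrom T a z)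
    (hpos : 0 < ⟪n, z - a⟫_ℝ) :
    ∃ x ∈ interior C, ∃ y ∈ interior D, IsGenericFrom T a x ∧ IsGenericFrom T a y ∧
      crossSum w (facets T) a y = crossSum w (facets T) a x + w (C ∩ D) := by
  have hside := (tendsto_add_smul_sub a z).eventually <| hT.eventually_mem_of_adjacent hC hD hadj hn
    (hT.mem_intrinsicInterior_of_mem_facets ⟨C, hC, hadj.1⟩ hz hzg.notMem_codimSkeleton)
  obtain ⟨t, ht, ht₀, hx, hxC, -⟩ := (eventually_mem_nhdsWithin.and
    (((eventually_ne_nhds one_ne_zero).filter_mono nhdsWithin_le_nhds).and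
      ((hT.eventually_crossed_add_smul_eq_of_lt ha z).and
        (hside.filter_mono nhdsWithin_le_nhds)))).exists
  obtain ⟨u, hu, hy, -, hyD, -⟩ := (eventually_mem_nhdsWithin.and
    ((hT.eventually_crossed_add_smul_eq_of_gt a z).and
      (hside.filter_mono nhdsWithin_le_nhds))).exists
  rw [inner_add_smul_sub_sub] at hxC hyD
  refine ⟨_, hxC (mul_neg_of_neg_of_pos (sub_neg.2 ht) hpos), _,
    hyD (mul_pos (sub_pos.2 hu) hpos), hzg.add_smul_sub ht₀,
    hzg.add_smul_sub (zero_lt_one.trans hu).ne', ?_⟩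
  have hfin := (hT.finite_crossed a z).subset (Set.sep_subset _ fun F => z ∉ F)
  calc crossSum w (facets T) a (a + u • (z - a))
      = ∑ᶠ F ∈ insert (C ∩ D) {F ∈ crossed (facets T) a z | z ∉ F}, w F := by
        rw [crossSum, hy, ← hT.crossed_eq_insert hC hadj hz hzg]
    _ = crossSum w (facets T) a (a + t • (z - a)) + w (C ∩ D) := by
        rw [finsum_mem_insert _ (fun h => h.2 hz) hfin, add_comm, crossSum, hx]

theorem IsBalanced.exists_potential [Module ℝ V] (hw : IsBalanced T a w)
    (hT : IsLocallyFiniteTiling T) (ha : IsGenericBase T a) :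
    ∃ A : Set (E d) → V, ∀ C ∈ T, ∀ D ∈ T, Adjacent C D → ∀ n, IsOuterNormal C (C ∩ D) n →
      ∀ z ∈ C ∩ D, 0 < ⟪n, z - a⟫_ℝ → A D = A C + w (C ∩ D) := by
  have hgen : ∀ C ∈ T, ∃ x, IsGenericFrom T a x ∧ x ∈ interior C := fun C hC =>
    (hT.dense_setOf_isGenericFrom a).exists_mem_open isOpen_interior (hT.polytope C hC).2
  choose! x hxg hx using hgen
  refine ⟨fun C => crossSum w (facets T) a (x C), fun C hC D hD hadj n hn z hz hpos => ?_⟩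
  obtain ⟨p, hp, hpg⟩ := hT.exists_isGenericFrom_mem hn.toIsHyperplaneNormal
    (ha.notMem_affineSpan ⟨C, hC, hadj.1⟩) (hadj.1.1.convex (hT.polytope C hC).convex) ⟨z, hz⟩
  rw [← hn.inner_sub_eq hp hz a] at hpos
  obtain ⟨y, hy, y', hy', hyg, hyg', hsum⟩ :=
    hT.exists_crossSum_eq_add ha w hC hD hadj hn hp hpg hpos
  dsimp only
  rw [hw.crossSum_eq_of_mem_interior hT ha hD (hx D hD) (hxg D hD) hy' hyg', hsum,
    hw.crossSum_eq_of_mem_interior hT ha hC (hx C hC) (hxg C hC) hy hyg]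

end Potential

/-! ### The generatrix of a canonical scaling -/

section Generatrix

variable {d : ℕ} {T : Set (Set (E d))} {F : Set (E d)} {a m n z : E d} {c : ℝ}
  {s : Set (E d) → ℝ}

/-- A continuous function on space whose restriction to each cell `C` is the affine function
`x ↦ ⟪g C, x⟫ + h C`, and whose gradient increases by `s F • n` when the facet `F` is crossed in
the direction of its unit normal `n`. It is encoded by the coefficients `g` and `h`; the condition
on `h` expresses continuity. -/
structure IsGeneratrix (T : Set (Set (E d))) (s : Set (E d) → ℝ) (g : Set (E d) → E d)
    (h : Set (E d) → ℝ) : Prop where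
  gradient_eq : ∀ C ∈ T, ∀ D ∈ T, Adjacent C D → ∀ n, IsOuterNormal C (C ∩ D) n →
    g D = g C + s (C ∩ D) • n
  constant_eq : ∀ C ∈ T, ∀ D ∈ T, Adjacent C D → ∀ n, IsOuterNormal C (C ∩ D) n →
    ∀ z ∈ C ∩ D, h D = h C - s (C ∩ D) * ⟪n, z⟫_ℝ

/-- The facet `F` lies in the hyperplane `{z | ⟪n, z⟫ = c}`, with unit normal `n`, and `a` lies on
the negative side of this hyperplane. -/
structure IsEquationSeenFrom (a : E d) (F : Set (E d)) (n : E d) (c : ℝ) : Prop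
    extends IsHyperplaneNormal F n where
  inner_eq : ∀ z ∈ F, ⟪n, z⟫_ℝ = c
  inner_lt : ⟪n, a⟫_ℝ < c

namespace IsEquationSeenFrom

theorem sign_smul_eq (hn : IsEquationSeenFrom a F n c) (hm : IsUnitNormal F m) (hz : z ∈ F) :
    (SignType.sign ⟪m, z - a⟫_ℝ : ℝ) • n = m := by
  have hpos : 0 < ⟪n, z - a⟫_ℝ := by
    rw [inner_sub_right, hn.inner_eq z hz]
    exact sub_pos.2 hn.inner_lt
  rcases hn.eq_or_eq_neg hm with rfl | rfl
  · simp [sign_pos hpos]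
  · simp [sign_neg (neg_neg_of_pos hpos)]

theorem eq_of_inner_sub_pos (hn : IsEquationSeenFrom a F n c) (hm : IsUnitNormal F m)
    (hz : z ∈ F) (hpos : 0 < ⟪m, z - a⟫_ℝ) : n = m := by
  simpa [sign_pos hpos] using hn.sign_smul_eq hm hz

end IsEquationSeenFrom

theorem IsGenericBase.exists_isEquationSeenFrom (ha : IsGenericBase T a) (hT : IsNormalTiling T)
    (hF : F ∈ facets T) : ∃ n c, IsEquationSeenFrom a F n c := by
  obtain ⟨n, hn⟩ := hT.exists_isHyperplaneNormal hF
  obtain ⟨p, hp⟩ : F.Nonempty := by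
    obtain ⟨C, -, hCF⟩ := hF
    exact hCF.1.1
  have hconst {m : E d} (hm : IsHyperplaneNormal F m) (z : E d) (hz : z ∈ F) :
      ⟪m, z⟫_ℝ = ⟪m, p⟫_ℝ := by
    rw [← sub_eq_zero, ← inner_sub_right, hm.inner_sub_eq_zero hz hp]
  rcases (hn.inner_sub_ne_zero (ha.notMem_affineSpan hF) hp).lt_or_gt with h | h
  · refine ⟨-n, _, hn.neg, hconst hn.neg, ?_⟩
    rwa [← sub_pos, ← inner_sub_right, inner_neg_left, neg_pos]
  · refine ⟨n, _, hn, hconst hn, ?_⟩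
    rwa [← sub_pos, ← inner_sub_right]

theorem IsCanonicalScaling.isBalanced (hs : IsCanonicalScaling T s)
    (hT : IsLocallyFiniteTiling T) {ν : Set (E d) → E d} {γ : Set (E d) → ℝ}
    (hν : ∀ F ∈ facets T, IsEquationSeenFrom a F (ν F) (γ F)) :
    IsBalanced T a fun F => s F • (ν F, -γ F) := by
  intro K hK e₁ e₂ he m hm p hp
  let L : E d →ₗ[ℝ] E d × ℝ := LinearMap.id.prod (-innerₗ (E d) p)
  have hterm : ∀ F ∈ facetsContaining T K,
      (SignType.sign ⟪m F, p - a⟫_ℝ : ℝ) • s F • (ν F, -γ F) = L (s F • m F) := by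
    rintro F ⟨hF, hKF⟩
    conv_rhs => rw [← (hν F hF).sign_smul_eq (hm F ⟨hF, hKF⟩).1 (hKF hp)]
    rw [smul_comm, map_smul, map_smul, ← (hν F hF).inner_eq p (hKF hp),
      real_inner_comm p]
    rfl
  have hfin : (facetsContaining T K).Finite :=
    (hT.finite_facets_mem p).subset fun F hF => ⟨hF.1, hF.2 hp⟩
  have htorsion : ∑ᶠ F ∈ facetsContaining T K, s F • m F = 0 :=
    hs.torsion_eq_zero K hK e₁ e₂ he m hm
  calc _ = ∑ᶠ F ∈ facetsContaining T K, L (s F • m F) := finsum_mem_congr rfl hterm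
    _ = L (∑ᶠ F ∈ facetsContaining T K, s F • m F) :=
        (L.toAddMonoidHom.map_finsum_mem _ hfin).symm
    _ = 0 := by rw [htorsion, map_zero]

theorem IsCanonicalScaling.exists_isGeneratrix (hs : IsCanonicalScaling T s)
    (hT : IsLocallyFiniteTiling T) : ∃ g h, IsGeneratrix T s g h := by
  obtain ⟨a, ha⟩ := hT.exists_isGenericBase
  have hequation := fun F hF => ha.exists_isEquationSeenFrom hT.toIsNormalTiling (F := F) hF
  choose! ν γ hν using hequation
  obtain ⟨A, hA⟩ := (hs.isBalanced hT hν).exists_potential hT ha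
  have hjump : ∀ C ∈ T, ∀ D ∈ T, Adjacent C D → ∀ n, IsOuterNormal C (C ∩ D) n → ∀ z ∈ C ∩ D,
      A D = A C + s (C ∩ D) • (n, -⟪n, z⟫_ℝ) := by
    intro C hC D hD hadj n hn z hz
    have hF : C ∩ D ∈ facets T := ⟨C, hC, hadj.1⟩
    rcases (hn.inner_sub_ne_zero (ha.notMem_affineSpan hF) hz).lt_or_gt with hneg | hpos
    · have hm := hT.isOuterNormal_neg hC hD hadj hn
      have hpos : 0 < ⟪-n, z - a⟫_ℝ := by rwa [inner_neg_left, neg_pos]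
      have hAC := hA D hD C hC hadj.symm (-n) (Set.inter_comm C D ▸ hm) z hz.symm hpos
      rw [Set.inter_comm D C, ← (hν _ hF).inner_eq z hz,
        (hν _ hF).eq_of_inner_sub_pos hm.isUnitNormal hz hpos] at hAC
      rw [hAC, add_assoc, ← smul_add]
      simp
    · rw [hA C hC D hD hadj n hn z hz hpos, ← (hν _ hF).inner_eq z hz,
        (hν _ hF).eq_of_inner_sub_pos hn.isUnitNormal hz hpos]
  refine ⟨fun C => (A C).1, fun C => (A C).2, fun C hC D hD hadj n hn => ?_,
    fun C hC D hD hadj n hn z hz => ?_⟩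
  · obtain ⟨z, hz⟩ := hadj.1.1.1
    simp [hjump C hC D hD hadj n hn z hz]
  · simp [hjump C hC D hD hadj n hn z hz, sub_eq_add_neg]

end Generatrix

/-! ### Translations of the tiling -/

section InnerProductSpace

variable {V : Type*} [NormedAddCommGroup V] [InnerProductSpace ℝ V]

theorem eq_of_vadd_eq_vadd {K : Set V} (hK : IsCompact K) (hne : K.Nonempty) {t u : V}
    (h : t +ᵥ K = u +ᵥ K) : t = u := by
  obtain ⟨x, hx, hmax⟩ := hK.exists_isMaxOn hne (f := fun y => ⟪t - u, y⟫_ℝ) (by fun_prop)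
  obtain ⟨y, hy, hyx⟩ : t +ᵥ x ∈ u +ᵥ K := h ▸ Set.vadd_mem_vadd_set hx
  obtain rfl : y = x + (t - u) := by
    rw [add_sub, add_comm x, eq_sub_iff_add_eq, add_comm y]
    exact hyx
  have hle : ⟪t - u, x + (t - u)⟫_ℝ ≤ ⟪t - u, x⟫_ℝ := hmax hy
  rwa [inner_add_right, add_le_iff_nonpos_right, real_inner_self_nonpos, sub_eq_zero] at hle

theorem span_eq_top_of_iUnion_vadd_eq_univ [FiniteDimensional ℝ V] {K S : Set V}
    (hK : Bornology.IsBounded K) (hcover : ⋃ t ∈ S, (t +ᵥ K) = Set.univ) :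
    Submodule.span ℝ S = ⊤ := by
  rw [← Submodule.orthogonal_eq_bot_iff, Submodule.eq_bot_iff]
  intro v hv
  obtain ⟨M, hM⟩ := hK.exists_norm_le
  have hbound : ∀ x, ⟪v, x⟫_ℝ ≤ ‖v‖ * M := by
    intro x
    obtain ⟨t, ht, y, hy, rfl⟩ := Set.mem_iUnion₂.1 (hcover.symm ▸ Set.mem_univ x)
    have hvt : ⟪v, t⟫_ℝ = 0 := Submodule.inner_left_of_mem_orthogonal (Submodule.subset_span ht) hv
    calc ⟪v, t +ᵥ y⟫_ℝ = ⟪v, y⟫_ℝ := by rw [vadd_eq_add, inner_add_right, hvt, zero_add]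
      _ ≤ ‖v‖ * ‖y‖ := real_inner_le_norm v y
      _ ≤ ‖v‖ * M := by gcongr; exact hM y hy
  by_contra hv0
  have hpos : 0 < ⟪v, v⟫_ℝ := real_inner_self_pos.2 hv0
  have hle := hbound (((‖v‖ * M + 1) / ⟪v, v⟫_ℝ) • v)
  rw [real_inner_smul_right, div_mul_cancel₀ _ hpos.ne'] at hle
  linarith

theorem exists_isSymmetric_eqOn [FiniteDimensional ℝ V] {S : Set V}
    (hS : Submodule.span ℝ S = ⊤) {q : V → V}
    (hq : ∀ t ∈ S, ∀ u ∈ S, ⟪q t, u⟫_ℝ = ⟪t, q u⟫_ℝ) :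
    ∃ L : V →ₗ[ℝ] V, L.IsSymmetric ∧ Set.EqOn L q S := by
  let B := Module.Basis.ofSpan hS.ge
  have hBS (i) : B i ∈ S := Module.Basis.ofSpan_subset hS.ge (Set.mem_range_self i)
  let L : V →ₗ[ℝ] V := B.constr ℝ fun i => q (B i)
  have hL (i) : L (B i) = q (B i) := B.constr_basis ℝ _ i
  have hsymm : L.IsSymmetric := by
    rw [LinearMap.isSymmetric_iff_isSelfAdjoint, isSelfAdjoint_iff, LinearMap.star_eq_adjoint,
      eq_comm, LinearMap.eq_adjoint_iff_basis B B]
    intro i j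
    rw [hL, hL, hq _ (hBS i) _ (hBS j)]
  refine ⟨L, hsymm, fun t ht => InnerProductSpace.ext_inner_right_basis B fun i => ?_⟩
  rw [hsymm t (B i), hL, hq t ht _ (hBS i)]

end InnerProductSpace

section Translation

variable {d : ℕ} {P : Set (E d)} {T : Set (Set (E d))} {C D F G : Set (E d)} {n : E d}
  {s : Set (E d) → ℝ} {g : Set (E d) → E d} {h : Set (E d) → ℝ}

theorem IsFace.vadd (hF : IsFace C F) (t : E d) : IsFace (t +ᵥ C) (t +ᵥ F) := by
  obtain ⟨l, rfl⟩ := hF.2 hF.1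
  refine ⟨hF.1.vadd_set, fun _ => ⟨l, ?_⟩⟩
  ext x
  simp only [Set.mem_vadd_set_iff_neg_vadd_mem, Set.mem_ofPred_eq, vadd_eq_add, map_add,
    and_congr_right_iff]
  intro _
  constructor
  · intro hmax y hy
    simpa using hmax _ hy
  · intro hmax y hy
    simpa [add_comm] using hmax (t + y) (by simpa using hy)

theorem IsFacet.vadd (hF : IsFacet C F) (t : E d) : IsFacet (t +ᵥ C) (t +ᵥ F) :=
  ⟨hF.1.vadd t, by rw [dim, vectorSpan_vadd]; exact hF.2⟩

theorem Adjacent.vadd (hadj : Adjacent C D) (t : E d) : Adjacent (t +ᵥ C) (t +ᵥ D) := by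
  rw [Adjacent, ← Set.vadd_set_inter]
  exact ⟨hadj.1.vadd t, hadj.2.vadd t⟩

namespace IsOuterNormal

theorem vadd (hn : IsOuterNormal C F n) (t : E d) : IsOuterNormal (t +ᵥ C) (t +ᵥ F) n := by
  refine ⟨⟨hn.norm_eq_one, by simpa only [vectorSpan_vadd] using hn.mem_vectorSpan_iff⟩, ?_⟩
  rintro _ ⟨z, hz, rfl⟩ _ ⟨y, hy, rfl⟩ hyF
  simpa using hn.inner_sub_neg z hz y hy fun hyF' => hyF (Set.vadd_mem_vadd_set hyF')

theorem facet_subset (hF : IsOuterNormal C F n) (hG : IsOuterNormal C G n) (hFC : F ⊆ C)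
    (hGC : G ⊆ C) (hne : G.Nonempty) : F ⊆ G := by
  intro x hx
  obtain ⟨z, hz⟩ := hne
  by_contra hxG
  have hlt := hG.inner_sub_neg z hz x (hFC hx) hxG
  have hle := hF.inner_sub_nonpos hx (hGC hz)
  rw [← neg_sub, inner_neg_right] at hle
  linarith

theorem facet_unique (hF : IsOuterNormal C F n) (hG : IsOuterNormal C G n) (hFC : IsFace C F)
    (hGC : IsFace C G) : F = G :=
  (hF.facet_subset hG hFC.subset hGC.subset hGC.1).antisymm
    (hG.facet_subset hF hGC.subset hFC.subset hFC.1)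

end IsOuterNormal

theorem IsFacet.exists_inter_eq (hT : IsLocallyFiniteTiling T) (hC : C ∈ T) (hF : IsFacet C F) :
    ∃ D ∈ T, C ∩ D = F ∧ Adjacent C D := by
  have hCp := hT.polytope C hC
  obtain ⟨n, hn⟩ := hF.exists_isOuterNormal hCp
  obtain ⟨a, ha⟩ := hT.exists_isGenericBase
  obtain ⟨z, hz, hzgen⟩ := hT.exists_isGenericFrom_mem hn.toIsHyperplaneNormal
    (ha.notMem_affineSpan ⟨C, hC, hF⟩) (hF.1.convex hCp.convex) hF.1.1
  exact hF.exists_adjacent hT hC hz hzgen.notMem_codimSkeleton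

namespace IsParallelohedralTiling

/-- The neighbour of `t +ᵥ C` across `t +ᵥ (C ∩ D)` is a translate `u +ᵥ D`, whose facet with the
same outer normal is `u +ᵥ (C ∩ D)`; hence `u = t`. -/
theorem vadd_mem_of_adjacent (hT : IsParallelohedralTiling P T) (hC : C ∈ T) (hD : D ∈ T)
    (hadj : Adjacent C D) {t : E d} (ht : t +ᵥ C ∈ T) : t +ᵥ D ∈ T := by
  have hCp := hT.tiling.polytope C hC
  obtain ⟨n, hn⟩ := hadj.1.exists_isOuterNormal hCp
  obtain ⟨D', hD', hinter, hadj'⟩ := (hadj.1.vadd t).exists_inter_eq hT.isLocallyFiniteTiling ht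
  obtain ⟨u, rfl⟩ := hT.exists_vadd_eq hD hD'
  have hn' := hT.tiling.isOuterNormal_neg ht hD' hadj' (hinter.symm ▸ hn.vadd t)
  have heq : (t +ᵥ C) ∩ (u +ᵥ D) = u +ᵥ (C ∩ D) :=
    hn'.facet_unique ((hT.tiling.isOuterNormal_neg hC hD hadj hn).vadd u) hadj'.2.1
      (hadj.2.1.vadd u)
  rw [eq_of_vadd_eq_vadd (hadj.1.1.isCompact hCp) hadj.1.1.1 (hinter.symm.trans heq)]
  exact hD'

theorem vadd_mem (hT : IsParallelohedralTiling P T) (hC : C ∈ T) (hD : D ∈ T) {t : E d}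
    (ht : t +ᵥ C ∈ T) : t +ᵥ D ∈ T := by
  have heq : {B ∈ T | t +ᵥ B ∈ T} = T :=
    hT.isLocallyFiniteTiling.eq_of_forall_adjacent_mem (Set.sep_subset _ _) ⟨C, hC, ht⟩
      fun _ hB B' hB' hadj => ⟨hB', hT.vadd_mem_of_adjacent hB.1 hB' hadj hB.2⟩
  exact (heq.ge hD).2

theorem vadd_image_eq (hT : IsParallelohedralTiling P T) (hC : C ∈ T) {t : E d}
    (ht : t +ᵥ C ∈ T) : (fun D : Set (E d) => t +ᵥ D) '' T = T := by
  refine (Set.image_subset_iff.2 fun D hD => hT.vadd_mem hC hD ht).antisymm fun D hD => ?_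
  exact ⟨-t +ᵥ D, hT.vadd_mem ht hD (by rwa [neg_vadd_vadd]), vadd_neg_vadd t D⟩

theorem span_translations_eq_top (hT : IsParallelohedralTiling P T) (hC : C ∈ T) :
    Submodule.span ℝ {t : E d | t +ᵥ C ∈ T} = ⊤ := by
  refine span_eq_top_of_iUnion_vadd_eq_univ (hT.tiling.polytope C hC).isCompact.isBounded ?_
  refine Set.eq_univ_of_forall fun x => ?_
  obtain ⟨D, hD, hxD⟩ : x ∈ ⋃₀ T := hT.tiling.cover ▸ Set.mem_univ x
  obtain ⟨t, rfl⟩ := hT.exists_vadd_eq hC hD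
  exact Set.mem_biUnion hD hxD

end IsParallelohedralTiling

/-- Translating by `t` changes all gradients by the same vector `q`, and all constant terms
accordingly, because it preserves the jumps across the facets. -/
theorem IsGeneratrix.exists_quasiperiod (hgh : IsGeneratrix T s g h)
    (hT : IsParallelohedralTiling P T) (hs : IsTranslationInvariant T s) (hC : C ∈ T) {t : E d}
    (ht : t +ᵥ C ∈ T) :
    ∃ (q : E d) (b : ℝ), ∀ D ∈ T, g (t +ᵥ D) = g D + q ∧ h (t +ᵥ D) = h D - ⟪g D, t⟫_ℝ + b := by
  let q := g (t +ᵥ C) - g C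
  let b := h (t +ᵥ C) - h C + ⟪g C, t⟫_ℝ
  have heq : {D ∈ T | g (t +ᵥ D) = g D + q ∧ h (t +ᵥ D) = h D - ⟪g D, t⟫_ℝ + b} = T := by
    refine hT.isLocallyFiniteTiling.eq_of_forall_adjacent_mem (Set.sep_subset _ _)
      ⟨C, hC, by simp [q], by simp [b]⟩ ?_
    rintro B ⟨hB, hgB, hhB⟩ D hD hadj
    obtain ⟨n, hn⟩ := hadj.1.exists_isOuterNormal (hT.tiling.polytope B hB)
    obtain ⟨z, hz⟩ := hadj.1.1.1
    have hBt := hT.vadd_mem hC hB ht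
    have hDt := hT.vadd_mem hC hD ht
    have hnt : IsOuterNormal (t +ᵥ B) ((t +ᵥ B) ∩ (t +ᵥ D)) n := by
      rw [← Set.vadd_set_inter]
      exact hn.vadd t
    have hzt : t +ᵥ z ∈ (t +ᵥ B) ∩ (t +ᵥ D) := by
      rw [← Set.vadd_set_inter]
      exact Set.vadd_mem_vadd_set hz
    have hst : s ((t +ᵥ B) ∩ (t +ᵥ D)) = s (B ∩ D) := by
      rw [← Set.vadd_set_inter, hs t (hT.vadd_image_eq hC ht) _ ⟨B, hB, hadj.1⟩]
    refine ⟨hD, ?_, ?_⟩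
    · rw [hgh.gradient_eq _ hBt _ hDt (hadj.vadd t) n hnt, hst, hgB,
        hgh.gradient_eq B hB D hD hadj n hn, add_right_comm]
    · rw [hgh.constant_eq _ hBt _ hDt (hadj.vadd t) n hnt _ hzt, hst, hhB,
        hgh.constant_eq B hB D hD hadj n hn z hz, hgh.gradient_eq B hB D hD hadj n hn,
        vadd_eq_add, inner_add_right, inner_add_left, real_inner_smul_left]
      ring
  exact ⟨q, b, fun D hD => (heq.ge hD).2⟩

theorem IsCanonicalScaling.exists_isSymmetric (hs : IsCanonicalScaling T s)
    (hinv : IsTranslationInvariant T s) (hT : IsParallelohedralTiling P T) (hC : C ∈ T) :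
    ∃ L : E d →ₗ[ℝ] E d, L.IsSymmetric ∧ ∀ t : E d, t +ᵥ C ∈ T → Adjacent C (t +ᵥ C) →
      ∀ n, IsOuterNormal C (C ∩ (t +ᵥ C)) n → L t = s (C ∩ (t +ᵥ C)) • n := by
  obtain ⟨g, h, hgh⟩ := hs.exists_isGeneratrix hT.isLocallyFiniteTiling
  have hquasi := fun (t : E d) (ht : t +ᵥ C ∈ T) => hgh.exists_quasiperiod hT hinv hC ht
  choose! q b hqb using hquasi
  have hsymm : ∀ t ∈ {t : E d | t +ᵥ C ∈ T}, ∀ u ∈ {u : E d | u +ᵥ C ∈ T},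
      ⟪q t, u⟫_ℝ = ⟪t, q u⟫_ℝ := by
    -- Compare the two expressions of the constant term on the cell `t +ᵥ u +ᵥ C`.
    intro t ht u hu
    have htu := (hqb t ht _ hu).2
    rw [vadd_comm t u C, (hqb u hu _ ht).2, (hqb t ht C hC).1, (hqb t ht C hC).2,
      (hqb u hu C hC).1, (hqb u hu C hC).2, inner_add_left, inner_add_left,
      real_inner_comm t (q u)] at htu
    linarith
  obtain ⟨L, hL, hLq⟩ := exists_isSymmetric_eqOn (hT.span_translations_eq_top hC) hsymm
  refine ⟨L, hL, fun t ht hadj n hn => ?_⟩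
  have hjump := hgh.gradient_eq C hC _ ht hadj n hn
  rw [(hqb t ht C hC).1] at hjump
  rw [hLq ht, add_left_cancel hjump]

end Translation

/-! ### Nondegeneracy and uniqueness -/

theorem exists_mem_segment_notMem_interior {V : Type*} [AddCommGroup V] [Module ℝ V]
    [TopologicalSpace V] [ContinuousAdd V] [ContinuousSMul ℝ V] {K : Set V} (hK : IsClosed K)
    {a b : V} (ha : a ∈ interior K) (hb : b ∉ K) :
    ∃ p ∈ segment ℝ a b, p ∈ K ∧ p ∉ interior K := by
  by_contra! hcon
  have hsub := (convex_segment a b).isPreconnected.subset_of_closure_inter_subset isOpen_interior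
    ⟨a, left_mem_segment ℝ a b, ha⟩ fun x hx =>
      hcon x hx.2 (closure_minimal interior_subset hK hx.1)
  exact hb (interior_subset (hsub (right_mem_segment ℝ a b)))

theorem exists_add_smul_notMem {V : Type*} [NormedAddCommGroup V] [NormedSpace ℝ V] {K : Set V}
    (hK : Bornology.IsBounded K) (a : V) {v : V} (hv : v ≠ 0) : ∃ c : ℝ, a + c • v ∉ K := by
  obtain ⟨R, hR⟩ := hK.exists_norm_le
  have hlim : Tendsto (fun c : ℝ => c * ‖v‖ - ‖a‖) atTop atTop :=
    tendsto_atTop_add_const_right atTop _ (tendsto_id.atTop_mul_const (norm_pos_iff.2 hv))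
  obtain ⟨c, hc⟩ := (hlim.eventually_gt_atTop R).exists
  refine ⟨c, fun hmem => hc.not_ge ?_⟩
  calc c * ‖v‖ - ‖a‖ ≤ ‖c • v‖ - ‖a‖ := by
        rw [norm_smul]
        gcongr
        exact le_abs_self c
    _ ≤ ‖a + c • v‖ := add_comm a _ ▸ norm_sub_le_norm_add (c • v) a
    _ ≤ R := hR _ hmem

section Normals

variable {d : ℕ} {T : Set (Set (E d))} {C : Set (E d)} {s : Set (E d) → ℝ}

/-- If `v` were nonzero, one could leave the bounded cell `C` from an interior point `a` through a
facet with outer normal `n` by moving to a point `b` for which `b - c • v` lies in `interior C`.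
Since `⟪n, v⟫ = 0`, the endpoint `b` would be on the inner side of that facet, like `a`. -/
theorem IsLocallyFiniteTiling.eq_zero_of_forall_inner_eq_zero (hT : IsLocallyFiniteTiling T)
    (hC : C ∈ T) {v : E d}
    (hv : ∀ D ∈ T, Adjacent C D → ∀ n, IsOuterNormal C (C ∩ D) n → ⟪n, v⟫_ℝ = 0) : v = 0 := by
  by_contra hv0
  have hCp := hT.polytope C hC
  obtain ⟨a, ha⟩ := hCp.2
  obtain ⟨c, hc⟩ := exists_add_smul_notMem hCp.isCompact.isBounded a hv0
  have hopen : IsOpen {b | b ∉ C ∧ b - c • v ∈ interior C} :=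
    hCp.isClosed.isOpen_compl.inter (isOpen_interior.preimage (by fun_prop))
  obtain ⟨b, hbgen, hbC, hbint⟩ :=
    (hT.dense_setOf_isGenericFrom a).exists_mem_open hopen ⟨a + c • v, hc, by simpa using ha⟩
  obtain ⟨p, hp, hpC, hpint⟩ := exists_mem_segment_notMem_interior hCp.isClosed ha hbC
  obtain ⟨D, hD, hpD, hadj⟩ := hT.exists_adjacent hC hpC hpint
    (hbgen.notMem_codimSkeleton_of_mem_segment (hT.notMem_codimSkeleton hC ha two_ne_zero) hp)
  obtain ⟨n, hn⟩ := hadj.1.exists_isOuterNormal hCp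
  have hneg {y : E d} (hy : y ∈ interior C) : ⟪n, y⟫_ℝ < ⟪n, p⟫_ℝ := by
    rw [← sub_neg, ← inner_sub_right]
    exact hn.inner_sub_neg_of_mem_interior hCp hadj.1 ⟨hpC, hpD⟩ hy
  have hb : ⟪n, b⟫_ℝ < ⟪n, p⟫_ℝ := by
    simpa [inner_sub_right, real_inner_smul_right, hv D hD hadj n hn] using hneg hbint
  have hhalf : segment ℝ a b ⊆ {x | ⟪n, x⟫_ℝ < ⟪n, p⟫_ℝ} :=
    (convex_halfSpace_lt (innerₗ (E d) n).isLinear _).segment_subset (hneg ha) hb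
  have hlt : ⟪n, p⟫_ℝ < ⟪n, p⟫_ℝ := hhalf hp
  exact hlt.false

theorem vecMul_columnMatrix {k : ℕ} (u : Fin d → ℝ) (v : Fin k → E d) (i : Fin k) :
    Matrix.vecMul u (columnMatrix v) i = ⟪v i, WithLp.toLp 2 u⟫_ℝ := by
  simp [Matrix.vecMul, dotProduct, columnMatrix, PiLp.inner_apply]

theorem IsCanonicalScaling.vecMul_columnMatrix_injective (hs : IsCanonicalScaling T s)
    (hT : IsLocallyFiniteTiling T) (hC : C ∈ T) {k : ℕ} {D : Fin k → Set (E d)}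
    (hD : Set.range D = {D' | D' ∈ T ∧ Adjacent C D'}) {n : Fin k → E d}
    (hn : ∀ i, IsUnitNormal (C ∩ D i) (n i)) :
    Function.Injective (columnMatrix fun i => s (C ∩ D i) • n i).vecMul := by
  rw [← Matrix.coe_vecMulLinear, ← LinearMap.ker_eq_bot, LinearMap.ker_eq_bot']
  intro u hu
  suffices WithLp.toLp 2 u = (0 : E d) by simpa using this
  refine hT.eq_zero_of_forall_inner_eq_zero hC fun D' hD' hadj ν hν => ?_
  obtain ⟨i, rfl⟩ : D' ∈ Set.range D := hD ▸ ⟨hD', hadj⟩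
  have hinner : s (C ∩ D i) * ⟪n i, WithLp.toLp 2 u⟫_ℝ = 0 := by
    rw [← real_inner_smul_left, ← vecMul_columnMatrix u fun i => s (C ∩ D i) • n i]
    exact congrFun hu i
  have hzero := (mul_eq_zero.1 hinner).resolve_left (hs.pos _ ⟨C, hC, hadj.1⟩).ne'
  rcases hν.eq_or_eq_neg (hn i) with h | h <;> simpa [h] using hzero

end Normals

section Matrices

variable {R m n : Type*} [Field R] [Fintype m] {A B : Matrix m m R} {N : Matrix m n R}

theorem isUnit_of_vecMul_mul_injective [DecidableEq m]
    (h : Function.Injective (A * N).vecMul) : IsUnit A := by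
  rw [← Matrix.vecMul_injective_iff_isUnit]
  refine Function.Injective.of_comp (f := N.vecMul) ?_
  simpa only [Function.comp_def, Matrix.vecMul_vecMul] using h

theorem eq_of_mul_eq_mul_of_vecMul_injective (h : Function.Injective (A * N).vecMul)
    (hAB : A * N = B * N) : A = B := by
  classical
  have hcomp : Function.Injective (N.vecMul ∘ A.vecMul) := by
    simpa only [Function.comp_def, Matrix.vecMul_vecMul] using h
  have hN : Function.Injective N.vecMul :=
    hcomp.of_comp_right (Matrix.vecMul_surjective_iff_isUnit.2 (isUnit_of_vecMul_mul_injective h))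
  funext i
  exact hN (congrFun hAB i)

theorem columnMatrix_toEuclideanLin {d k : ℕ} (Q : Matrix (Fin d) (Fin d) ℝ) (v : Fin k → E d) :
    columnMatrix (fun i => Q.toEuclideanLin (v i)) = Q * columnMatrix v :=
  rfl

theorem exists_isSymm_toEuclideanLin_eq {d : ℕ} {L : E d →ₗ[ℝ] E d}
    (hL : L.IsSymmetric) : ∃ Q : Matrix (Fin d) (Fin d) ℝ, Q.IsSymm ∧ Q.toEuclideanLin = L := by
  refine ⟨Matrix.toEuclideanLin.symm L, ?_, LinearEquiv.apply_symm_apply _ L⟩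
  rw [Matrix.IsSymm, ← Matrix.conjTranspose_eq_transpose_of_trivial]
  exact Matrix.isSymmetric_toEuclideanLin_iff.1 (by rwa [LinearEquiv.apply_symm_apply])

end Matrices

end Parallelohedra

theorem mainTheorem8 {d : ℕ} (P : Set (Parallelohedra.E d)) (T : Set (Set (Parallelohedra.E d)))
    (hT : Parallelohedra.IsParallelohedralTiling P T)
    (s : Set (Parallelohedra.E d) → ℝ)
    (hs : Parallelohedra.IsCanonicalScaling T s)
    (hinv : Parallelohedra.IsTranslationInvariant T s)
    (P₀ : Set (Parallelohedra.E d)) (hP₀ : P₀ ∈ T)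
    (k : ℕ) (C : Fin k → Set (Parallelohedra.E d)) (hCinj : Function.Injective C)
    (hC : Set.range C = {C' | C' ∈ T ∧ Parallelohedra.Adjacent P₀ C'})
    (n : Fin k → Parallelohedra.E d)
    (hn : ∀ i, Parallelohedra.IsUnitNormalFromTo P₀ (C i) (n i))
    (p m : Fin k → Parallelohedra.E d)
    (hp : ∀ i, p i = Parallelohedra.cellCenter (C i) - Parallelohedra.cellCenter P₀)
    (hm : ∀ i, m i = s (P₀ ∩ C i) • n i) :
    ∃! Q : Matrix (Fin d) (Fin d) ℝ,
      Q.IsSymm ∧ Q.det ≠ 0 ∧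
        Parallelohedra.columnMatrix m = Q * Parallelohedra.columnMatrix p := by
  have hT' := hT.isLocallyFiniteTiling
  have hP := hT.tiling.polytope P₀ hP₀
  have hCi (i) : C i ∈ T ∧ Parallelohedra.Adjacent P₀ (C i) := hC.subset (Set.mem_range_self i)
  have hC_eq (i) : C i = p i +ᵥ P₀ := by
    obtain ⟨t, ht⟩ := hT.exists_vadd_eq hP₀ (hCi i).1
    rw [hp i, ht, Parallelohedra.cellCenter_vadd hP, add_sub_cancel_right]
  obtain ⟨L, hLsymm, hL⟩ := hs.exists_isSymmetric hinv hT hP₀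
  obtain ⟨Q, hQsymm, rfl⟩ := Parallelohedra.exists_isSymm_toEuclideanLin_eq hLsymm
  have hQp (i) : m i = Q.toEuclideanLin (p i) := by
    have hni := (hn i).isOuterNormal hP (hCi i).2
    rw [hC_eq i] at hni
    rw [hm i, hC_eq i, hL (p i) (hC_eq i ▸ (hCi i).1) (hC_eq i ▸ (hCi i).2) (n i) hni]
  have hM : Parallelohedra.columnMatrix m = Q * Parallelohedra.columnMatrix p := by
    rw [← Parallelohedra.columnMatrix_toEuclideanLin, funext hQp]
  have hinj : Function.Injective (Q * Parallelohedra.columnMatrix p).vecMul := by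
    rw [← hM, funext hm]
    exact hs.vecMul_columnMatrix_injective hT' hP₀ hC fun i => (hn i).1
  have hdet := ((Matrix.isUnit_iff_isUnit_det Q).1
    (Parallelohedra.isUnit_of_vecMul_mul_injective hinj)).ne_zero
  exact ⟨Q, ⟨hQsymm, hdet, hM⟩, fun Q' ⟨_, _, hM'⟩ =>
    (Parallelohedra.eq_of_mul_eq_mul_of_vecMul_injective hinj (hM.symm.trans hM')).symm⟩
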